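/- Let $X$ be a compact Hausdorff space and $A=C(X)=C(X,\mathbb C)$. Let $\mathcal H=(\mathcal H_L,\mathcal H_R,S)$ be a Hopf algebroid over $A$ with bijective antipode, the ground ring being $\mathbb C$: thus $\mathcal H_L=(H,s_L,t_L,\Delta_L,\epsilon_L)$ is a left bialgebroid over a $\mathbb C$-algebra $L$, $\mathcal H_R=(H,s_R,t_R,\Delta_R,\epsilon_R)$ is a right bialgebroid over $R=A$ with the same total $\mathbb C$-algebra $H$, and $S:H\to H$ is a $\mathbb C$-linear bijection such that (a) $s_L\epsilon_Lt_R=t_R$, $t_R\epsilon_Rs_L=s_L$, $t_L\epsilon_Ls_R=s_R$, $s_R\epsilon_Rt_L=t_L$; (b) $(\Delta_L\otimes_R\mathrm{id})\Delta_R=(\mathrm{id}\otimes_L\Delta_R)\Delta_L$ and $(\Delta_R\otimes_L\mathrm{id})\Delta_L=(\mathrm{id}\otimes_R\Delta_L)\Delta_R$; (c) $S(t_L(l)\,h\,t_R(r))=s_R(r)\,S(h)\,s_L(l)$ for all $l\in L$, $r\in R$, $h\in H$; (d) $\mu(S\otimes_L\mathrm{id})\Delta_L=s_R\epsilon_R$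 and $\mu(\mathrm{id}\otimes_RS)\Delta_R=s_L\epsilon_L$. Assume that $H$ is finitely generated and projective as an $A$-module (through $s_R$), that the images of $A$ under the source and target maps are central in $H$, and that $A$ sits in $H$ as a single central subalgebra, i.e. $s_R=t_R$. Then $\mathcal H$ is a bundle of complex Hopf algebroids over $X$. That is, there are a complex vector bundle $E\to X$ of finite (locally constant) rank, for every $x\in X$ a structure $\mathcal H_x=(H^L_x,H^R_x,S_x)$ of Hopf algebroid with bijective antipode, with $k=L=R=\mathbb C$, on the fibre $E_x$, such that unit, multiplication, both coproducts, both counits, the antipode and its inverse are continuous maps of bundles, and isomorphisms of $\mathbb C$-algebras $\Phi:H\to\Gamma(X,E)$ (continuous sections with pointwise multiplication) and $\theta:L\to C(X)$ such that all structure is computed fibrewise: for every $x\in X$ the maps $h\mapsto\Phi(h)(x)$, $l\mapsto\theta(l)(x)$ and $f\mapsto f(x)$ form a geometric morphism of Hopf algebroids $\mathcal H\to\mathcal H_x$, i.e. they commute with the sources, targets, counits and coproducts of the left and of the right bialgebroids and with the antipodes. -/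

import Mathlib

open scoped TensorProduct Topology
open MulOpposite

universe u v w

noncomputable section

/-! ### Tensor products over a (possibly noncommutative) base -/

/-- For `k`-modules `M`, `N` and families of `k`-linear operators `ρ a` on `M` (a right action of
`A`) and `σ a` on `N` (a left action of `A`): the submodule of `M ⊗[k] N` spanned by the elements
`ρ a m ⊗ n - m ⊗ σ a n`. The quotient by it is the balanced tensor product `M ⊗_A N`. -/
def balancedRel (k : Type*) [CommRing k] {A M N : Type*}
    [AddCommGroup M] [Module k M] [AddCommGroup N] [Module k N]
    (ρ : A → M →ₗ[k] M) (σ : A → N →ₗ[k] N) : Submodule k (M ⊗[k] N) :=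
  Submodule.span k {z | ∃ (a : A) (m : M) (n : N), z = ρ a m ⊗ₜ[k] n - m ⊗ₜ[k] σ a n}

/-- The balanced tensor product `M ⊗_A N`. -/
abbrev BalancedTensor (k : Type*) [CommRing k] {A M N : Type*}
    [AddCommGroup M] [Module k M] [AddCommGroup N] [Module k N]
    (ρ : A → M →ₗ[k] M) (σ : A → N →ₗ[k] N) : Type _ :=
  (M ⊗[k] N) ⧸ balancedRel k ρ σ

/-- The relations defining `M ⊗_A N ⊗_B P` as a quotient of `M ⊗[k] (N ⊗[k] P)`. -/
def balancedRel₃ (k : Type*) [CommRing k] {A B M N P : Type*}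
    [AddCommGroup M] [Module k M] [AddCommGroup N] [Module k N] [AddCommGroup P] [Module k P]
    (ρ : A → M →ₗ[k] M) (σ : A → N →ₗ[k] N) (ρ' : B → N →ₗ[k] N) (σ' : B → P →ₗ[k] P) :
    Submodule k (M ⊗[k] (N ⊗[k] P)) :=
  Submodule.span k
    ({z | ∃ (a : A) (m : M) (n : N) (p : P),
        z = ρ a m ⊗ₜ[k] (n ⊗ₜ[k] p) - m ⊗ₜ[k] (σ a n ⊗ₜ[k] p)} ∪
     {z | ∃ (b : B) (m : M) (n : N) (p : P),
        z = m ⊗ₜ[k] (ρ' b n ⊗ₜ[k] p) - m ⊗ₜ[k] (n ⊗ₜ[k] σ' b p)})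

/-- The threefold balanced tensor product `M ⊗_A N ⊗_B P`. -/
abbrev BalancedTensor₃ (k : Type*) [CommRing k] {A B M N P : Type*}
    [AddCommGroup M] [Module k M] [AddCommGroup N] [Module k N] [AddCommGroup P] [Module k P]
    (ρ : A → M →ₗ[k] M) (σ : A → N →ₗ[k] N) (ρ' : B → N →ₗ[k] N) (σ' : B → P →ₗ[k] P) : Type _ :=
  (M ⊗[k] (N ⊗[k] P)) ⧸ balancedRel₃ k ρ σ ρ' σ'

/-- The canonical surjection `M ⊗[k] (N ⊗_B P) → M ⊗_A N ⊗_B P`. -/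
def balancedOfRight (k : Type*) [CommRing k] {A B M N P : Type*}
    [AddCommGroup M] [Module k M] [AddCommGroup N] [Module k N] [AddCommGroup P] [Module k P]
    (ρ : A → M →ₗ[k] M) (σ : A → N →ₗ[k] N) (ρ' : B → N →ₗ[k] N) (σ' : B → P →ₗ[k] P) :
    M ⊗[k] BalancedTensor k ρ' σ' →ₗ[k] BalancedTensor₃ k ρ σ ρ' σ' :=
  TensorProduct.lift
    ((balancedRel k ρ' σ').liftQ
      ((TensorProduct.mk k M (N ⊗[k] P)).compr₂ (balancedRel₃ k ρ σ ρ' σ').mkQ).flip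
      (by
        refine Submodule.span_le.2 ?_
        rintro _ ⟨b, n, p, rfl⟩
        refine LinearMap.mem_ker.2 (LinearMap.ext fun m => ?_)
        simp only [map_sub, LinearMap.sub_apply, LinearMap.flip_apply, LinearMap.compr₂_apply,
          TensorProduct.mk_apply, LinearMap.zero_apply]
        rw [← map_sub, Submodule.mkQ_apply, Submodule.Quotient.mk_eq_zero]
        exact Submodule.subset_span (Or.inr ⟨b, m, n, p, rfl⟩))).flip

/-- The canonical surjection `(M ⊗_A N) ⊗[k] P → M ⊗_A N ⊗_B P`. -/
def balancedOfLeft (k : Type*) [CommRing k] {A B M N P : Type*}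
    [AddCommGroup M] [Module k M] [AddCommGroup N] [Module k N] [AddCommGroup P] [Module k P]
    (ρ : A → M →ₗ[k] M) (σ : A → N →ₗ[k] N) (ρ' : B → N →ₗ[k] N) (σ' : B → P →ₗ[k] P) :
    BalancedTensor k ρ σ ⊗[k] P →ₗ[k] BalancedTensor₃ k ρ σ ρ' σ' :=
  TensorProduct.lift
    ((balancedRel k ρ σ).liftQ
      (TensorProduct.curry ((balancedRel₃ k ρ σ ρ' σ').mkQ ∘ₗ
        (TensorProduct.assoc k M N P).toLinearMap))
      (by
        refine Submodule.span_le.2 ?_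
        rintro _ ⟨a, m, n, rfl⟩
        refine LinearMap.mem_ker.2 (LinearMap.ext fun p => ?_)
        simp only [map_sub, LinearMap.sub_apply, TensorProduct.curry_apply, LinearMap.comp_apply,
          LinearEquiv.coe_coe, TensorProduct.assoc_tmul, LinearMap.zero_apply]
        rw [← map_sub, Submodule.mkQ_apply, Submodule.Quotient.mk_eq_zero]
        exact Submodule.subset_span (Or.inl ⟨a, m, n, p, rfl⟩)))

/-! ### Bialgebroids

Conditions on the value `Δ h` of a coproduct, an element of a quotient of `H ⊗[k] H`, are written
in terms of an arbitrary representative `u ∈ H ⊗[k] H` of `Δ h`; `u` plays the role of the Sweedler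
expression `∑ h₁ ⊗ h₂`. -/

/-- A left `L`-bialgebroid over the commutative ring `k` with total algebra `H`. The `L`-bimodule
structure of `H` is `l · h · l' = s l * t l' * h`. -/
structure LeftBialgebroid (k L H : Type*) [CommRing k] [Ring L] [Algebra k L]
    [Ring H] [Algebra k H] where
  /-- source map -/
  s : L →ₐ[k] H
  /-- target map -/
  t : Lᵐᵒᵖ →ₐ[k] H
  s_t_comm : ∀ l l' : L, s l * t (op l') = t (op l') * s l
  /-- coproduct `H → H ⊗_L H` -/
  Δ : H →ₗ[k] BalancedTensor k (fun l : L => LinearMap.mulLeft k (t (op l)))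
    (fun l : L => LinearMap.mulLeft k (s l))
  /-- counit -/
  ε : H →ₗ[k] L
  /-- `Δ` is a map of left `L`-modules -/
  Δ_s_mul : ∀ (l : L) (h : H) (u : H ⊗[k] H), Submodule.Quotient.mk u = Δ h →
    Δ (s l * h) = Submodule.Quotient.mk ((s l ⊗ₜ[k] 1) * u)
  /-- `Δ` is a map of right `L`-modules -/
  Δ_t_mul : ∀ (l : L) (h : H) (u : H ⊗[k] H), Submodule.Quotient.mk u = Δ h →
    Δ (t (op l) * h) = Submodule.Quotient.mk ((1 ⊗ₜ[k] t (op l)) * u)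
  /-- `ε` is a map of left `L`-modules -/
  ε_s_mul : ∀ (l : L) (h : H), ε (s l * h) = l * ε h
  /-- `ε` is a map of right `L`-modules -/
  ε_t_mul : ∀ (l : L) (h : H), ε (t (op l) * h) = ε h * l
  /-- coassociativity `(Δ ⊗ id) ∘ Δ = (id ⊗ Δ) ∘ Δ` in `H ⊗_L H ⊗_L H` -/
  coassoc : ∀ (h : H) (u : H ⊗[k] H), Submodule.Quotient.mk u = Δ h →
    balancedOfLeft k (fun l : L => LinearMap.mulLeft k (t (op l)))
        (fun l : L => LinearMap.mulLeft k (s l))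
        (fun l : L => LinearMap.mulLeft k (t (op l)))
        (fun l : L => LinearMap.mulLeft k (s l)) (TensorProduct.map Δ LinearMap.id u) =
      balancedOfRight k (fun l : L => LinearMap.mulLeft k (t (op l)))
        (fun l : L => LinearMap.mulLeft k (s l))
        (fun l : L => LinearMap.mulLeft k (t (op l)))
        (fun l : L => LinearMap.mulLeft k (s l)) (TensorProduct.map LinearMap.id Δ u)
  /-- counit axiom `s (ε h₁) * h₂ = h` -/
  counit_left : ∀ (h : H) (u : H ⊗[k] H), Submodule.Quotient.mk u = Δ h →
    LinearMap.mul' k H (TensorProduct.map (s.toLinearMap ∘ₗ ε) LinearMap.id u) = h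
  /-- counit axiom `t (ε h₂) * h₁ = h` -/
  counit_right : ∀ (h : H) (u : H ⊗[k] H), Submodule.Quotient.mk u = Δ h →
    LinearMap.mul' k H (TensorProduct.comm k H H (TensorProduct.map LinearMap.id
      (t.toLinearMap ∘ₗ (opLinearEquiv k : L ≃ₗ[k] Lᵐᵒᵖ).toLinearMap ∘ₗ ε) u)) = h
  /-- `Δ h` lies in the Takeuchi product: `h₁ * t l ⊗ h₂ = h₁ ⊗ h₂ * s l` -/
  takeuchi : ∀ (h : H) (u : H ⊗[k] H), Submodule.Quotient.mk u = Δ h → ∀ l : L,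
    (Submodule.Quotient.mk (u * (t (op l) ⊗ₜ[k] 1)) :
      BalancedTensor k (fun l : L => LinearMap.mulLeft k (t (op l)))
        (fun l : L => LinearMap.mulLeft k (s l))) = Submodule.Quotient.mk (u * (1 ⊗ₜ[k] s l))
  /-- `Δ` is unital -/
  Δ_one : Δ 1 = Submodule.Quotient.mk (1 ⊗ₜ[k] 1)
  /-- `Δ` is multiplicative for the factorwise product -/
  Δ_mul : ∀ (h h' : H) (u u' : H ⊗[k] H), Submodule.Quotient.mk u = Δ h →
    Submodule.Quotient.mk u' = Δ h' → Δ (h * h') = Submodule.Quotient.mk (u * u')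
  /-- `h ▷ l = ε (h * s l)` is a unital left action of `H` on `L` (unit law) -/
  ε_one : ε 1 = 1
  /-- `h ▷ l = ε (h * s l)` is a left action of `H` on `L` (associativity) -/
  ε_mul : ∀ h h' : H, ε (h * s (ε h')) = ε (h * h')

/-- A right `R`-bialgebroid over the commutative ring `k` with total algebra `H`. The `R`-bimodule
structure of `H` is `r · h · r' = h * s r' * t r`. -/
structure RightBialgebroid (k R H : Type*) [CommRing k] [Ring R] [Algebra k R]
    [Ring H] [Algebra k H] where
  /-- source map -/
  s : R →ₐ[k] H
  /-- target map -/
  t : Rᵐᵒᵖ →ₐ[k] H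
  s_t_comm : ∀ r r' : R, s r * t (op r') = t (op r') * s r
  /-- coproduct `H → H ⊗_R H` -/
  Δ : H →ₗ[k] BalancedTensor k (fun r : R => LinearMap.mulRight k (s r))
    (fun r : R => LinearMap.mulRight k (t (op r)))
  /-- counit -/
  ε : H →ₗ[k] R
  /-- `Δ` is a map of right `R`-modules -/
  Δ_mul_s : ∀ (r : R) (h : H) (u : H ⊗[k] H), Submodule.Quotient.mk u = Δ h →
    Δ (h * s r) = Submodule.Quotient.mk (u * (1 ⊗ₜ[k] s r))
  /-- `Δ` is a map of left `R`-modules -/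
  Δ_mul_t : ∀ (r : R) (h : H) (u : H ⊗[k] H), Submodule.Quotient.mk u = Δ h →
    Δ (h * t (op r)) = Submodule.Quotient.mk (u * (t (op r) ⊗ₜ[k] 1))
  /-- `ε` is a map of right `R`-modules -/
  ε_mul_s : ∀ (r : R) (h : H), ε (h * s r) = ε h * r
  /-- `ε` is a map of left `R`-modules -/
  ε_mul_t : ∀ (r : R) (h : H), ε (h * t (op r)) = r * ε h
  /-- coassociativity `(Δ ⊗ id) ∘ Δ = (id ⊗ Δ) ∘ Δ` in `H ⊗_R H ⊗_R H` -/
  coassoc : ∀ (h : H) (u : H ⊗[k] H), Submodule.Quotient.mk u = Δ h →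
    balancedOfLeft k (fun r : R => LinearMap.mulRight k (s r))
        (fun r : R => LinearMap.mulRight k (t (op r)))
        (fun r : R => LinearMap.mulRight k (s r))
        (fun r : R => LinearMap.mulRight k (t (op r))) (TensorProduct.map Δ LinearMap.id u) =
      balancedOfRight k (fun r : R => LinearMap.mulRight k (s r))
        (fun r : R => LinearMap.mulRight k (t (op r)))
        (fun r : R => LinearMap.mulRight k (s r))
        (fun r : R => LinearMap.mulRight k (t (op r))) (TensorProduct.map LinearMap.id Δ u)
  /-- counit axiom `h₂ * t (ε h₁) = h` -/
  counit_left : ∀ (h : H) (u : H ⊗[k] H), Submodule.Quotient.mk u = Δ h →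
    LinearMap.mul' k H (TensorProduct.comm k H H (TensorProduct.map
      (t.toLinearMap ∘ₗ (opLinearEquiv k : R ≃ₗ[k] Rᵐᵒᵖ).toLinearMap ∘ₗ ε) LinearMap.id u)) = h
  /-- counit axiom `h₁ * s (ε h₂) = h` -/
  counit_right : ∀ (h : H) (u : H ⊗[k] H), Submodule.Quotient.mk u = Δ h →
    LinearMap.mul' k H (TensorProduct.map LinearMap.id (s.toLinearMap ∘ₗ ε) u) = h
  /-- `Δ h` lies in the Takeuchi product: `s r * h₁ ⊗ h₂ = h₁ ⊗ t r * h₂` -/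
  takeuchi : ∀ (h : H) (u : H ⊗[k] H), Submodule.Quotient.mk u = Δ h → ∀ r : R,
    (Submodule.Quotient.mk ((s r ⊗ₜ[k] 1) * u) :
      BalancedTensor k (fun r : R => LinearMap.mulRight k (s r))
        (fun r : R => LinearMap.mulRight k (t (op r)))) =
      Submodule.Quotient.mk ((1 ⊗ₜ[k] t (op r)) * u)
  /-- `Δ` is unital -/
  Δ_one : Δ 1 = Submodule.Quotient.mk (1 ⊗ₜ[k] 1)
  /-- `Δ` is multiplicative for the factorwise product -/
  Δ_mul : ∀ (h h' : H) (u u' : H ⊗[k] H), Submodule.Quotient.mk u = Δ h →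
    Submodule.Quotient.mk u' = Δ h' → Δ (h * h') = Submodule.Quotient.mk (u * u')
  /-- `r ◁ h = ε (s r * h)` is a unital right action of `H` on `R` (unit law) -/
  ε_one : ε 1 = 1
  /-- `r ◁ h = ε (s r * h)` is a right action of `H` on `R` (associativity) -/
  ε_mul : ∀ h h' : H, ε (s (ε h) * h') = ε (h * h')

/-! ### Hopf algebroids -/

/-- A Hopf algebroid with bijective antipode over the commutative ring `k`: a left `L`-bialgebroid
and a right `R`-bialgebroid on the same total `k`-algebra `H`, with an antipode `S`. -/
structure HopfAlgebroid (k L R H : Type*) [CommRing k] [Ring L] [Algebra k L]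
    [Ring R] [Algebra k R] [Ring H] [Algebra k H] where
  /-- the constituent left bialgebroid -/
  left : LeftBialgebroid k L H
  /-- the constituent right bialgebroid -/
  right : RightBialgebroid k R H
  /-- the bijective antipode -/
  S : H ≃ₗ[k] H
  sL_εL_tR : ∀ r : R, left.s (left.ε (right.t (op r))) = right.t (op r)
  tR_εR_sL : ∀ l : L, right.t (op (right.ε (left.s l))) = left.s l
  tL_εL_sR : ∀ r : R, left.t (op (left.ε (right.s r))) = right.s r
  sR_εR_tL : ∀ l : L, right.s (right.ε (left.t (op l))) = left.t (op l)
  /-- `(Δ_L ⊗_R id) ∘ Δ_R = (id ⊗_L Δ_R) ∘ Δ_L` in `H ⊗_L H ⊗_R H` -/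
  coassoc_LR : ∀ (h : H) (u v : H ⊗[k] H), Submodule.Quotient.mk u = right.Δ h →
    Submodule.Quotient.mk v = left.Δ h →
    balancedOfLeft k (fun l : L => LinearMap.mulLeft k (left.t (op l)))
        (fun l : L => LinearMap.mulLeft k (left.s l))
        (fun r : R => LinearMap.mulRight k (right.s r))
        (fun r : R => LinearMap.mulRight k (right.t (op r)))
        (TensorProduct.map left.Δ LinearMap.id u) =
      balancedOfRight k (fun l : L => LinearMap.mulLeft k (left.t (op l)))
        (fun l : L => LinearMap.mulLeft k (left.s l))
        (fun r : R => LinearMap.mulRight k (right.s r))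
        (fun r : R => LinearMap.mulRight k (right.t (op r)))
        (TensorProduct.map LinearMap.id right.Δ v)
  /-- `(Δ_R ⊗_L id) ∘ Δ_L = (id ⊗_R Δ_L) ∘ Δ_R` in `H ⊗_R H ⊗_L H` -/
  coassoc_RL : ∀ (h : H) (u v : H ⊗[k] H), Submodule.Quotient.mk u = left.Δ h →
    Submodule.Quotient.mk v = right.Δ h →
    balancedOfLeft k (fun r : R => LinearMap.mulRight k (right.s r))
        (fun r : R => LinearMap.mulRight k (right.t (op r)))
        (fun l : L => LinearMap.mulLeft k (left.t (op l)))
        (fun l : L => LinearMap.mulLeft k (left.s l))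
        (TensorProduct.map right.Δ LinearMap.id u) =
      balancedOfRight k (fun r : R => LinearMap.mulRight k (right.s r))
        (fun r : R => LinearMap.mulRight k (right.t (op r)))
        (fun l : L => LinearMap.mulLeft k (left.t (op l)))
        (fun l : L => LinearMap.mulLeft k (left.s l))
        (TensorProduct.map LinearMap.id left.Δ v)
  S_mul : ∀ (l : L) (r : R) (h : H),
    S (left.t (op l) * h * right.t (op r)) = right.s r * S h * left.s l
  /-- `S h₁ * h₂ = s_R (ε_R h)` for the left coproduct -/
  antipode_left : ∀ (h : H) (u : H ⊗[k] H), Submodule.Quotient.mk u = left.Δ h →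
    LinearMap.mul' k H (TensorProduct.map S.toLinearMap LinearMap.id u) = right.s (right.ε h)
  /-- `h₁ * S h₂ = s_L (ε_L h)` for the right coproduct -/
  antipode_right : ∀ (h : H) (u : H ⊗[k] H), Submodule.Quotient.mk u = right.Δ h →
    LinearMap.mul' k H (TensorProduct.map LinearMap.id S.toLinearMap u) = left.s (left.ε h)

/-- The total algebra of a Hopf algebroid as a (left) module over the base algebra `R`, through
multiplication by the source map `s_R`. -/
abbrev HopfAlgebroid.sourceModule {k L R H : Type*} [CommRing k] [Ring L] [Algebra k L]
    [Ring R] [Algebra k R] [Ring H] [Algebra k H] (𝓗 : HopfAlgebroid k L R H) : Module R H :=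
  Module.compHom H (𝓗.right.s : R →+* H)

/-- A geometric morphism of Hopf algebroids: algebra maps `fL`, `fR` of the bases and `φ` of the
total algebras that intertwine sources, targets, counits, coproducts and antipodes. -/
structure HopfAlgebroid.IsGeometricMorphism {k L R H L' R' H' : Type*} [CommRing k]
    [Ring L] [Algebra k L] [Ring R] [Algebra k R] [Ring H] [Algebra k H]
    [Ring L'] [Algebra k L'] [Ring R'] [Algebra k R'] [Ring H'] [Algebra k H']
    (𝓗 : HopfAlgebroid k L R H) (𝓗' : HopfAlgebroid k L' R' H')
    (fL : L →ₐ[k] L') (fR : R →ₐ[k] R') (φ : H →ₐ[k] H') : Prop where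
  sL : ∀ l : L, φ (𝓗.left.s l) = 𝓗'.left.s (fL l)
  tL : ∀ l : L, φ (𝓗.left.t (op l)) = 𝓗'.left.t (op (fL l))
  εL : ∀ h : H, fL (𝓗.left.ε h) = 𝓗'.left.ε (φ h)
  sR : ∀ r : R, φ (𝓗.right.s r) = 𝓗'.right.s (fR r)
  tR : ∀ r : R, φ (𝓗.right.t (op r)) = 𝓗'.right.t (op (fR r))
  εR : ∀ h : H, fR (𝓗.right.ε h) = 𝓗'.right.ε (φ h)
  ΔL : ∀ (h : H) (u : H ⊗[k] H), Submodule.Quotient.mk u = 𝓗.left.Δ h →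
    𝓗'.left.Δ (φ h) = Submodule.Quotient.mk (TensorProduct.map φ.toLinearMap φ.toLinearMap u)
  ΔR : ∀ (h : H) (u : H ⊗[k] H), Submodule.Quotient.mk u = 𝓗.right.Δ h →
    𝓗'.right.Δ (φ h) = Submodule.Quotient.mk (TensorProduct.map φ.toLinearMap φ.toLinearMap u)
  S : ∀ h : H, φ (𝓗.S h) = 𝓗'.S (φ h)

/-! ### Bundles of complex Hopf algebroids -/

/-- `E` is a complex vector bundle of finite rank over `X` for the given topology on its total
space; the rank is locally constant but may differ from one component of `X` to another.
(The first argument of `Bundle.TotalSpace` is a dummy.) -/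
def IsFiniteRankVectorBundle {X : Type*} [TopologicalSpace X] (E : X → Type*)
    [∀ x, AddCommGroup (E x)] [∀ x, Module ℂ (E x)]
    [TopologicalSpace (Bundle.TotalSpace Unit E)] : Prop :=
  ∀ x₀ : X, ∃ (n : ℕ)
    (e : Bundle.Trivialization (Fin n → ℂ) (Bundle.TotalSpace.proj (F := Unit) (E := E))),
    x₀ ∈ e.baseSet ∧
      ∀ x ∈ e.baseSet, IsLinearMap ℂ (fun v : E x => (e (Bundle.TotalSpace.mk x v)).2)

/-- The section `σ` of `E` is continuous on the set `U`. -/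
def SectionContinuousOn {X : Type*} [TopologicalSpace X] {E : X → Type*}
    [TopologicalSpace (Bundle.TotalSpace Unit E)] (σ : ∀ x, E x) (U : Set X) : Prop :=
  ContinuousOn (fun x => (Bundle.TotalSpace.mk x (σ x) : Bundle.TotalSpace Unit E)) U

/-- The section `x ↦ τ x` of (a fibrewise quotient `Q` of) the tensor square of `E` is continuous
on `U`: near every point of `U` it is a finite sum `∑ a i ⊗ b i` of tensor products of continuous
sections of `E`. -/
def TensorSectionContinuousOn {X : Type*} [TopologicalSpace X] {E : X → Type*}
    [∀ x, AddCommGroup (E x)] [∀ x, Module ℂ (E x)]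
    [TopologicalSpace (Bundle.TotalSpace Unit E)]
    (Q : ∀ x, Submodule ℂ (E x ⊗[ℂ] E x)) (τ : ∀ x, (E x ⊗[ℂ] E x) ⧸ Q x) (U : Set X) : Prop :=
  ∀ x₀ ∈ U, ∃ V : Set X, IsOpen V ∧ x₀ ∈ V ∧ ∃ (n : ℕ) (a b : Fin n → ∀ x, E x),
    (∀ i, SectionContinuousOn (a i) (V ∩ U)) ∧ (∀ i, SectionContinuousOn (b i) (V ∩ U)) ∧
    ∀ x ∈ V ∩ U, τ x = Submodule.Quotient.mk (∑ i, a i x ⊗ₜ[ℂ] b i x)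

/-- A bundle of complex Hopf algebroids over `X`: a complex vector bundle of finite rank whose
fibres carry Hopf algebroid structures over `ℂ` (with `k = L = R = ℂ`), all structure maps being
continuous bundle maps; the fibre product of the bundle with itself has the topology induced from the
product of total spaces. (In a fibre over `ℂ` the sources and targets are the unit map.) -/
structure HopfAlgebroidBundle (X : Type u) [TopologicalSpace X] where
  /-- the fibres -/
  fiber : X → Type v
  [ring : ∀ x, Ring (fiber x)]
  [algebra : ∀ x, Algebra ℂ (fiber x)]
  [topology : TopologicalSpace (Bundle.TotalSpace Unit fiber)]
  isVectorBundle : IsFiniteRankVectorBundle fiber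
  /-- the Hopf algebroid structures of the fibres -/
  hopf : ∀ x, HopfAlgebroid ℂ ℂ ℂ (fiber x)
  continuous_one : Continuous
    (fun x => (Bundle.TotalSpace.mk x 1 : Bundle.TotalSpace Unit fiber))
  continuous_mul : Continuous[
    TopologicalSpace.induced
      (fun p : Bundle.TotalSpace Unit (fun x => fiber x × fiber x) =>
        ((Bundle.TotalSpace.mk p.proj p.snd.1 : Bundle.TotalSpace Unit fiber),
          (Bundle.TotalSpace.mk p.proj p.snd.2 : Bundle.TotalSpace Unit fiber))) inferInstance,
    topology]
    (fun p => Bundle.TotalSpace.mk p.proj (p.snd.1 * p.snd.2))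
  continuous_εL : Continuous
    (fun p : Bundle.TotalSpace Unit fiber => (hopf p.proj).left.ε p.snd)
  continuous_εR : Continuous
    (fun p : Bundle.TotalSpace Unit fiber => (hopf p.proj).right.ε p.snd)
  continuous_S : Continuous
    (fun p : Bundle.TotalSpace Unit fiber =>
      (Bundle.TotalSpace.mk p.proj ((hopf p.proj).S p.snd) : Bundle.TotalSpace Unit fiber))
  continuous_S_symm : Continuous
    (fun p : Bundle.TotalSpace Unit fiber =>
      (Bundle.TotalSpace.mk p.proj ((hopf p.proj).S.symm p.snd) : Bundle.TotalSpace Unit fiber))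
  continuous_ΔL : ∀ (U : Set X), IsOpen U → ∀ σ : ∀ x, fiber x, SectionContinuousOn σ U →
    TensorSectionContinuousOn _ (fun x => (hopf x).left.Δ (σ x)) U
  continuous_ΔR : ∀ (U : Set X), IsOpen U → ∀ σ : ∀ x, fiber x, SectionContinuousOn σ U →
    TensorSectionContinuousOn _ (fun x => (hopf x).right.Δ (σ x)) U

attribute [instance] HopfAlgebroidBundle.ring HopfAlgebroidBundle.algebra
  HopfAlgebroidBundle.topology

/-- The set of (globally) continuous sections of a bundle of complex Hopf algebroids, a subset of
the algebra `∀ x, 𝓔.fiber x` with pointwise operations. -/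
def HopfAlgebroidBundle.sections {X : Type u} [TopologicalSpace X] (𝓔 : HopfAlgebroidBundle.{u, v} X) :
    Set (∀ x, 𝓔.fiber x) :=
  {σ | Continuous
    (fun x => (Bundle.TotalSpace.mk x (σ x) : Bundle.TotalSpace Unit 𝓔.fiber))}

end

/-! Write `A = C(X)`. Since `s_R = t_R` has central image, `H` is an algebra over `A`, and its fibre
at `x` is the quotient `E_x` of `H` by the ideal generated by `s_R f` with `f x = 0`, two-sided by
centrality. The proof has an algebraic half (the structure passes to `E_x`) and a topological half
(the `E_x` form a bundle whose sections are `H`).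

Algebra. The relations between sources, targets and counits, read with `s_R = t_R`, show that `θ =
ε_R s_L` is an isomorphism `L ≃ A` and that `s_L = t_L = s_R θ` (`baseEquiv`, `sL_eq`, `tL_eq`). So
all four maps have the same central image, and counits, coproducts and antipode are compatible with
multiplication by it; they therefore kill, in the fibre, multiples of functions vanishing at `x`,
and descend (`eq_zero_of_mem_fiberIdeal`). The axioms speak of arbitrary representatives of
coproducts. Every representative over `E_x` lifts to one over `H` (`exists_balanced_lift`), so each
axiom on `E_x` is the image of the axiom on `H`.

Topology. This is the Serre–Swan argument. A finite dual basis `b j`, `c j` of the projective module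
`H` embeds `E_x` in `ℂ^n` as the range of the idempotent matrix `e x = (c i (b j) x)`, continuous in
`x`. The matrix `g x₀ x = e x₀ e x + (1 - e x₀)(1 - e x)` intertwines `e x` and `e x₀` and is `1` at
`x = x₀`, hence invertible nearby; it trivializes the family locally. With the topology induced from
`X × ℂ^n`, structure maps are continuous once their values on the `b j` are, and those come from
elements of `H` or `A`. Finally `h` is recovered from its coefficient functions, and a continuous
section has continuous coefficients, so `H` is exactly the algebra of continuous sections. -/

noncomputable section

/-! ### Functoriality of balanced tensor products -/

section Balanced

variable {k : Type*} [CommRing k] {A A' B B' M N P M' N' P' : Type*}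
  [AddCommGroup M] [Module k M] [AddCommGroup N] [Module k N] [AddCommGroup P] [Module k P]
  [AddCommGroup M'] [Module k M'] [AddCommGroup N'] [Module k N'] [AddCommGroup P'] [Module k P']
  {ρ : A → M →ₗ[k] M} {σ : A → N →ₗ[k] N} {ρ' : A' → M' →ₗ[k] M'} {σ' : A' → N' →ₗ[k] N'}
  {ρ₂ : B → N →ₗ[k] N} {σ₂ : B → P →ₗ[k] P} {ρ₂' : B' → N' →ₗ[k] N'} {σ₂' : B' → P' →ₗ[k] P'}

/-- The map of balanced tensor products induced by equivariant maps of the factors. -/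
def balancedMap (f : A → A') (φ : M →ₗ[k] M') (ψ : N →ₗ[k] N')
    (hρ : ∀ a m, φ (ρ a m) = ρ' (f a) (φ m)) (hσ : ∀ a n, ψ (σ a n) = σ' (f a) (ψ n)) :
    BalancedTensor k ρ σ →ₗ[k] BalancedTensor k ρ' σ' :=
  Submodule.mapQ _ _ (TensorProduct.map φ ψ) (by
    refine Submodule.span_le.2 ?_
    rintro _ ⟨a, m, n, rfl⟩
    refine Submodule.subset_span ⟨f a, φ m, ψ n, ?_⟩
    simp only [map_sub, TensorProduct.map_tmul, hρ, hσ])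

theorem balancedMap_mk (f : A → A') (φ : M →ₗ[k] M') (ψ : N →ₗ[k] N')
    (hρ : ∀ a m, φ (ρ a m) = ρ' (f a) (φ m)) (hσ : ∀ a n, ψ (σ a n) = σ' (f a) (ψ n))
    (u : M ⊗[k] N) :
    balancedMap f φ ψ hρ hσ (Submodule.Quotient.mk u) =
      Submodule.Quotient.mk (TensorProduct.map φ ψ u) := rfl

/-- The map of threefold balanced tensor products induced by equivariant maps of the factors. -/
def balancedMap₃ (f : A → A') (g : B → B') (φ : M →ₗ[k] M') (ψ : N →ₗ[k] N') (χ : P →ₗ[k] P')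
    (hρ : ∀ a m, φ (ρ a m) = ρ' (f a) (φ m)) (hσ : ∀ a n, ψ (σ a n) = σ' (f a) (ψ n))
    (hρ₂ : ∀ b n, ψ (ρ₂ b n) = ρ₂' (g b) (ψ n)) (hσ₂ : ∀ b p, χ (σ₂ b p) = σ₂' (g b) (χ p)) :
    BalancedTensor₃ k ρ σ ρ₂ σ₂ →ₗ[k] BalancedTensor₃ k ρ' σ' ρ₂' σ₂' :=
  Submodule.mapQ _ _ (TensorProduct.map φ (TensorProduct.map ψ χ)) (by
    refine Submodule.span_le.2 ?_
    rintro _ (⟨a, m, n, p, rfl⟩ | ⟨b, m, n, p, rfl⟩)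
    · refine Submodule.subset_span (Or.inl ⟨f a, φ m, ψ n, χ p, ?_⟩)
      simp only [map_sub, TensorProduct.map_tmul, hρ, hσ]
    · refine Submodule.subset_span (Or.inr ⟨g b, φ m, ψ n, χ p, ?_⟩)
      simp only [map_sub, TensorProduct.map_tmul, hρ₂, hσ₂])

/-- Naturality of the projection to the threefold product. With `balancedOfRight_map` it turns a
coassociativity law into its image under `balancedMap₃`. -/
theorem balancedOfLeft_map (f : A → A') (g : B → B') (φ : M →ₗ[k] M') (ψ : N →ₗ[k] N')
    (χ : P →ₗ[k] P')
    (hρ : ∀ a m, φ (ρ a m) = ρ' (f a) (φ m)) (hσ : ∀ a n, ψ (σ a n) = σ' (f a) (ψ n))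
    (hρ₂ : ∀ b n, ψ (ρ₂ b n) = ρ₂' (g b) (ψ n)) (hσ₂ : ∀ b p, χ (σ₂ b p) = σ₂' (g b) (χ p))
    (z : BalancedTensor k ρ σ ⊗[k] P) :
    balancedOfLeft k ρ' σ' ρ₂' σ₂' (TensorProduct.map (balancedMap f φ ψ hρ hσ) χ z) =
      balancedMap₃ f g φ ψ χ hρ hσ hρ₂ hσ₂ (balancedOfLeft k ρ σ ρ₂ σ₂ z) := by
  induction z with
  | zero => simp only [map_zero]
  | add x y hx hy => simp only [map_add, hx, hy]
  | tmul y p =>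
    obtain ⟨y, rfl⟩ := Submodule.Quotient.mk_surjective _ y
    induction y with
    | zero => simp only [Submodule.Quotient.mk_zero, TensorProduct.zero_tmul, map_zero]
    | add x y hx hy =>
      simp only [Submodule.Quotient.mk_add, TensorProduct.add_tmul, map_add, hx, hy]
    | tmul m n => rfl

theorem balancedOfRight_map (f : A → A') (g : B → B') (φ : M →ₗ[k] M') (ψ : N →ₗ[k] N')
    (χ : P →ₗ[k] P')
    (hρ : ∀ a m, φ (ρ a m) = ρ' (f a) (φ m)) (hσ : ∀ a n, ψ (σ a n) = σ' (f a) (ψ n))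
    (hρ₂ : ∀ b n, ψ (ρ₂ b n) = ρ₂' (g b) (ψ n)) (hσ₂ : ∀ b p, χ (σ₂ b p) = σ₂' (g b) (χ p))
    (z : M ⊗[k] BalancedTensor k ρ₂ σ₂) :
    balancedOfRight k ρ' σ' ρ₂' σ₂' (TensorProduct.map φ (balancedMap g ψ χ hρ₂ hσ₂) z) =
      balancedMap₃ f g φ ψ χ hρ hσ hρ₂ hσ₂ (balancedOfRight k ρ σ ρ₂ σ₂ z) := by
  induction z with
  | zero => simp only [map_zero]
  | add x y hx hy => simp only [map_add, hx, hy]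
  | tmul m y =>
    obtain ⟨y, rfl⟩ := Submodule.Quotient.mk_surjective _ y
    induction y with
    | zero => simp only [Submodule.Quotient.mk_zero, TensorProduct.tmul_zero, map_zero]
    | add x y hx hy =>
      simp only [Submodule.Quotient.mk_add, TensorProduct.tmul_add, map_add, hx, hy]
    | tmul n p => rfl

/-- Representatives in a balanced tensor product lift along surjections of the factors. -/
theorem exists_balanced_lift {f : A → A'} {φ : M →ₗ[k] M'} {ψ : N →ₗ[k] N'}
    (hf : Function.Surjective f) (hφ : Function.Surjective φ) (hψ : Function.Surjective ψ)
    (hρ : ∀ a m, φ (ρ a m) = ρ' (f a) (φ m)) (hσ : ∀ a n, ψ (σ a n) = σ' (f a) (ψ n))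
    (u : M ⊗[k] N) (u' : M' ⊗[k] N')
    (h : (Submodule.Quotient.mk u' : BalancedTensor k ρ' σ') =
      Submodule.Quotient.mk (TensorProduct.map φ ψ u)) :
    ∃ v : M ⊗[k] N, (Submodule.Quotient.mk v : BalancedTensor k ρ σ) = Submodule.Quotient.mk u ∧
      TensorProduct.map φ ψ v = u' := by
  -- Surjectivity makes each generating relation of the target the image of a generating relation of
  -- the source, so the discrepancy between `u'` and the image of `u` is the image of some relation
  -- `r`, which corrects `u`.
  have key : balancedRel k ρ' σ' ≤ (balancedRel k ρ σ).map (TensorProduct.map φ ψ) := by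
    refine Submodule.span_le.2 ?_
    rintro _ ⟨a, m, n, rfl⟩
    obtain ⟨a, rfl⟩ := hf a
    obtain ⟨m, rfl⟩ := hφ m
    obtain ⟨n, rfl⟩ := hψ n
    refine ⟨ρ a m ⊗ₜ n - m ⊗ₜ σ a n, Submodule.subset_span ⟨a, m, n, rfl⟩, ?_⟩
    simp only [map_sub, TensorProduct.map_tmul, hρ, hσ]
  obtain ⟨r, hr, hr'⟩ := key ((Submodule.Quotient.eq _).1 h)
  refine ⟨u + r, (Submodule.Quotient.eq _).2 (by simpa using hr), ?_⟩
  rw [map_add, hr']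
  abel

end Balanced

/-! ### Descent of bialgebroids and Hopf algebroids along surjections -/

section Descent

variable {k L L' H H' : Type*} [CommRing k] [Ring L] [Algebra k L] [Ring L'] [Algebra k L']
  [Ring H] [Algebra k H] [Ring H'] [Algebra k H']

theorem tensorMap_mul (φ : H →ₐ[k] H') (u v : H ⊗[k] H) :
    TensorProduct.map φ.toLinearMap φ.toLinearMap (u * v) =
      TensorProduct.map φ.toLinearMap φ.toLinearMap u *
        TensorProduct.map φ.toLinearMap φ.toLinearMap v :=
  map_mul (Algebra.TensorProduct.map φ φ) u v

theorem mul'_tensorMap (φ : H →ₐ[k] H') (u : H ⊗[k] H) :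
    LinearMap.mul' k H' (TensorProduct.map φ.toLinearMap φ.toLinearMap u) =
      φ (LinearMap.mul' k H u) := by
  induction u with
  | zero => simp only [map_zero]
  | add x y hx hy => simp only [map_add, hx, hy]
  | tmul m n => simp

theorem tensorMap_tensorMap_left {M N M' N' P Q : Type*} [AddCommGroup M] [Module k M]
    [AddCommGroup N] [Module k N] [AddCommGroup M'] [Module k M'] [AddCommGroup N'] [Module k N']
    [AddCommGroup P] [Module k P] [AddCommGroup Q] [Module k Q]
    {φ : M →ₗ[k] M'} {ψ : N →ₗ[k] N'} {T : M →ₗ[k] P} {T' : M' →ₗ[k] Q} {F : P →ₗ[k] Q}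
    (h : ∀ m, T' (φ m) = F (T m)) (u : M ⊗[k] N) :
    TensorProduct.map T' LinearMap.id (TensorProduct.map φ ψ u) =
      TensorProduct.map F ψ (TensorProduct.map T LinearMap.id u) := by
  induction u with
  | zero => simp only [map_zero]
  | add x y hx hy => simp only [map_add, hx, hy]
  | tmul m n => simp [h]

theorem tensorMap_tensorMap_right {M N M' N' P Q : Type*} [AddCommGroup M] [Module k M]
    [AddCommGroup N] [Module k N] [AddCommGroup M'] [Module k M'] [AddCommGroup N'] [Module k N']
    [AddCommGroup P] [Module k P] [AddCommGroup Q] [Module k Q]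
    {φ : M →ₗ[k] M'} {ψ : N →ₗ[k] N'} {T : N →ₗ[k] P} {T' : N' →ₗ[k] Q} {F : P →ₗ[k] Q}
    (h : ∀ m, T' (ψ m) = F (T m)) (u : M ⊗[k] N) :
    TensorProduct.map LinearMap.id T' (TensorProduct.map φ ψ u) =
      TensorProduct.map φ F (TensorProduct.map LinearMap.id T u) := by
  induction u with
  | zero => simp only [map_zero]
  | add x y hx hy => simp only [map_add, hx, hy]
  | tmul m n => simp [h]

theorem comm_tensorMap (φ : H →ₐ[k] H') (u : H ⊗[k] H) :
    TensorProduct.comm k H' H' (TensorProduct.map φ.toLinearMap φ.toLinearMap u) =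
      TensorProduct.map φ.toLinearMap φ.toLinearMap (TensorProduct.comm k H H u) := by
  induction u with
  | zero => simp only [map_zero]
  | add x y hx hy => simp only [map_add, hx, hy]
  | tmul m n => simp

/-- Data on `H'` compatible with a left bialgebroid structure on `H` along surjections. -/
structure LeftBialgebroid.DescentData (B : LeftBialgebroid k L H) (f : L →ₐ[k] L')
    (φ : H →ₐ[k] H') where
  f_surj : Function.Surjective f
  φ_surj : Function.Surjective φ
  s : L' →ₐ[k] H'
  t : L'ᵐᵒᵖ →ₐ[k] H'
  Δ : H' →ₗ[k] BalancedTensor k (fun l : L' => LinearMap.mulLeft k (t (op l)))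
    (fun l : L' => LinearMap.mulLeft k (s l))
  ε : H' →ₗ[k] L'
  map_s : ∀ l, φ (B.s l) = s (f l)
  map_t : ∀ l, φ (B.t (op l)) = t (op (f l))
  map_Δ : ∀ h u, Submodule.Quotient.mk u = B.Δ h →
    Δ (φ h) = Submodule.Quotient.mk (TensorProduct.map φ.toLinearMap φ.toLinearMap u)
  map_ε : ∀ h, ε (φ h) = f (B.ε h)

namespace LeftBialgebroid.DescentData

variable {B : LeftBialgebroid k L H} {f : L →ₐ[k] L'} {φ : H →ₐ[k] H'} (D : B.DescentData f φ)

theorem map_mulLeft_t (l : L) (h : H) :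
    φ.toLinearMap (LinearMap.mulLeft k (B.t (op l)) h) =
      LinearMap.mulLeft k (D.t (op (f l))) (φ.toLinearMap h) := by
  simp [D.map_t]

theorem map_mulLeft_s (l : L) (h : H) :
    φ.toLinearMap (LinearMap.mulLeft k (B.s l) h) =
      LinearMap.mulLeft k (D.s (f l)) (φ.toLinearMap h) := by
  simp [D.map_s]

/-- In this form the compatibility can be substituted inside a tensor factor, as coassociativity
requires. -/
theorem map_Δ' (h : H) : D.Δ (φ.toLinearMap h) =
    balancedMap f φ.toLinearMap φ.toLinearMap D.map_mulLeft_t D.map_mulLeft_s (B.Δ h) := by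
  obtain ⟨u, hu⟩ := Submodule.Quotient.mk_surjective _ (B.Δ h)
  rw [← hu, balancedMap_mk]
  exact D.map_Δ h u hu

/-- Axioms on `H'` quantify over all representatives of a coproduct; this reduces them to images of
representatives in `H ⊗ H`, where the axiom of `B` applies. -/
theorem exists_rep (h : H) (u' : H' ⊗[k] H') (hu' : Submodule.Quotient.mk u' = D.Δ (φ h)) :
    ∃ u, Submodule.Quotient.mk u = B.Δ h ∧
      TensorProduct.map φ.toLinearMap φ.toLinearMap u = u' := by
  obtain ⟨u, hu⟩ := Submodule.Quotient.mk_surjective _ (B.Δ h)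
  rw [D.map_Δ h u hu] at hu'
  obtain ⟨v, hv, hv'⟩ := exists_balanced_lift D.f_surj D.φ_surj D.φ_surj
    D.map_mulLeft_t D.map_mulLeft_s u u' hu'
  exact ⟨v, hv.trans hu, hv'⟩

/-- The left bialgebroid structure on a quotient. -/
def toLeftBialgebroid : LeftBialgebroid k L' H' where
  s := D.s
  t := D.t
  Δ := D.Δ
  ε := D.ε
  s_t_comm := by
    intro l l'
    obtain ⟨l, rfl⟩ := D.f_surj l
    obtain ⟨l', rfl⟩ := D.f_surj l'
    rw [← D.map_s, ← D.map_t, ← map_mul, B.s_t_comm, map_mul]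
  Δ_s_mul := by
    intro l h u' hu'
    obtain ⟨l, rfl⟩ := D.f_surj l
    obtain ⟨h, rfl⟩ := D.φ_surj h
    obtain ⟨u, hu, rfl⟩ := D.exists_rep h u' hu'
    rw [← D.map_s, ← map_mul, D.map_Δ _ _ (B.Δ_s_mul l h u hu).symm, tensorMap_mul]
    simp
  Δ_t_mul := by
    intro l h u' hu'
    obtain ⟨l, rfl⟩ := D.f_surj l
    obtain ⟨h, rfl⟩ := D.φ_surj h
    obtain ⟨u, hu, rfl⟩ := D.exists_rep h u' hu'
    rw [← D.map_t, ← map_mul, D.map_Δ _ _ (B.Δ_t_mul l h u hu).symm, tensorMap_mul]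
    simp
  ε_s_mul := by
    intro l h
    obtain ⟨l, rfl⟩ := D.f_surj l
    obtain ⟨h, rfl⟩ := D.φ_surj h
    rw [← D.map_s, ← map_mul, D.map_ε, B.ε_s_mul, map_mul, D.map_ε]
  ε_t_mul := by
    intro l h
    obtain ⟨l, rfl⟩ := D.f_surj l
    obtain ⟨h, rfl⟩ := D.φ_surj h
    rw [← D.map_t, ← map_mul, D.map_ε, B.ε_t_mul, map_mul, D.map_ε]
  coassoc := by
    intro h u' hu'
    obtain ⟨h, rfl⟩ := D.φ_surj h
    obtain ⟨u, hu, rfl⟩ := D.exists_rep h u' hu'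
    rw [tensorMap_tensorMap_left D.map_Δ', tensorMap_tensorMap_right D.map_Δ',
      balancedOfLeft_map f f _ _ _ D.map_mulLeft_t D.map_mulLeft_s
        D.map_mulLeft_t D.map_mulLeft_s,
      balancedOfRight_map f f _ _ _ D.map_mulLeft_t D.map_mulLeft_s
        D.map_mulLeft_t D.map_mulLeft_s, B.coassoc h u hu]
  counit_left := by
    intro h u' hu'
    obtain ⟨h, rfl⟩ := D.φ_surj h
    obtain ⟨u, hu, rfl⟩ := D.exists_rep h u' hu'
    rw [tensorMap_tensorMap_left (T := B.s.toLinearMap ∘ₗ B.ε) (F := φ.toLinearMap)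
      (fun m => by simp [D.map_ε, D.map_s]), mul'_tensorMap, B.counit_left h u hu]
  counit_right := by
    intro h u' hu'
    obtain ⟨h, rfl⟩ := D.φ_surj h
    obtain ⟨u, hu, rfl⟩ := D.exists_rep h u' hu'
    rw [tensorMap_tensorMap_right (T := B.t.toLinearMap ∘ₗ
        (opLinearEquiv k : L ≃ₗ[k] Lᵐᵒᵖ).toLinearMap ∘ₗ B.ε) (F := φ.toLinearMap)
      (fun m => by simp [D.map_ε, D.map_t]), comm_tensorMap, mul'_tensorMap,
      B.counit_right h u hu]
  takeuchi := by
    intro h u' hu' l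
    obtain ⟨l, rfl⟩ := D.f_surj l
    obtain ⟨h, rfl⟩ := D.φ_surj h
    obtain ⟨u, hu, rfl⟩ := D.exists_rep h u' hu'
    have := congrArg (balancedMap (ρ' := fun l => LinearMap.mulLeft k (D.t (op l)))
      (σ' := fun l => LinearMap.mulLeft k (D.s l)) f φ.toLinearMap φ.toLinearMap
      D.map_mulLeft_t D.map_mulLeft_s) (B.takeuchi h u hu l)
    simpa only [balancedMap_mk, tensorMap_mul, TensorProduct.map_tmul, AlgHom.toLinearMap_apply,
      map_one, D.map_s, D.map_t] using this
  Δ_one := by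
    rw [← map_one φ, D.map_Δ _ _ B.Δ_one.symm]
    simp
  Δ_mul := by
    intro h₁ h₂ u₁' u₂' hu₁' hu₂'
    obtain ⟨h₁, rfl⟩ := D.φ_surj h₁
    obtain ⟨h₂, rfl⟩ := D.φ_surj h₂
    obtain ⟨u₁, hu₁, rfl⟩ := D.exists_rep _ _ hu₁'
    obtain ⟨u₂, hu₂, rfl⟩ := D.exists_rep _ _ hu₂'
    rw [← map_mul, D.map_Δ _ _ (B.Δ_mul _ _ _ _ hu₁ hu₂).symm, tensorMap_mul]
  ε_one := by rw [← map_one φ, D.map_ε, B.ε_one, map_one]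
  ε_mul := by
    intro h₁ h₂
    obtain ⟨h₁, rfl⟩ := D.φ_surj h₁
    obtain ⟨h₂, rfl⟩ := D.φ_surj h₂
    rw [D.map_ε, ← D.map_s, ← map_mul, ← map_mul, D.map_ε, D.map_ε, B.ε_mul]

end LeftBialgebroid.DescentData

/-- Data on `H'` compatible with a right bialgebroid structure on `H` along surjections. -/
structure RightBialgebroid.DescentData (B : RightBialgebroid k L H) (f : L →ₐ[k] L')
    (φ : H →ₐ[k] H') where
  f_surj : Function.Surjective f
  φ_surj : Function.Surjective φ
  s : L' →ₐ[k] H'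
  t : L'ᵐᵒᵖ →ₐ[k] H'
  Δ : H' →ₗ[k] BalancedTensor k (fun r : L' => LinearMap.mulRight k (s r))
    (fun r : L' => LinearMap.mulRight k (t (op r)))
  ε : H' →ₗ[k] L'
  map_s : ∀ l, φ (B.s l) = s (f l)
  map_t : ∀ l, φ (B.t (op l)) = t (op (f l))
  map_Δ : ∀ h u, Submodule.Quotient.mk u = B.Δ h →
    Δ (φ h) = Submodule.Quotient.mk (TensorProduct.map φ.toLinearMap φ.toLinearMap u)
  map_ε : ∀ h, ε (φ h) = f (B.ε h)

namespace RightBialgebroid.DescentData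

variable {B : RightBialgebroid k L H} {f : L →ₐ[k] L'} {φ : H →ₐ[k] H'} (D : B.DescentData f φ)

theorem map_mulRight_t (l : L) (h : H) :
    φ.toLinearMap (LinearMap.mulRight k (B.t (op l)) h) =
      LinearMap.mulRight k (D.t (op (f l))) (φ.toLinearMap h) := by
  simp [D.map_t]

theorem map_mulRight_s (l : L) (h : H) :
    φ.toLinearMap (LinearMap.mulRight k (B.s l) h) =
      LinearMap.mulRight k (D.s (f l)) (φ.toLinearMap h) := by
  simp [D.map_s]

theorem map_Δ' (h : H) : D.Δ (φ.toLinearMap h) =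
    balancedMap f φ.toLinearMap φ.toLinearMap D.map_mulRight_s D.map_mulRight_t (B.Δ h) := by
  obtain ⟨u, hu⟩ := Submodule.Quotient.mk_surjective _ (B.Δ h)
  rw [← hu, balancedMap_mk]
  exact D.map_Δ h u hu

theorem exists_rep (h : H) (u' : H' ⊗[k] H') (hu' : Submodule.Quotient.mk u' = D.Δ (φ h)) :
    ∃ u, Submodule.Quotient.mk u = B.Δ h ∧
      TensorProduct.map φ.toLinearMap φ.toLinearMap u = u' := by
  obtain ⟨u, hu⟩ := Submodule.Quotient.mk_surjective _ (B.Δ h)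
  rw [D.map_Δ h u hu] at hu'
  obtain ⟨v, hv, hv'⟩ := exists_balanced_lift D.f_surj D.φ_surj D.φ_surj
    D.map_mulRight_s D.map_mulRight_t u u' hu'
  exact ⟨v, hv.trans hu, hv'⟩

/-- The right bialgebroid structure on a quotient. -/
def toRightBialgebroid : RightBialgebroid k L' H' where
  s := D.s
  t := D.t
  Δ := D.Δ
  ε := D.ε
  s_t_comm := by
    intro l l'
    obtain ⟨l, rfl⟩ := D.f_surj l
    obtain ⟨l', rfl⟩ := D.f_surj l'
    rw [← D.map_s, ← D.map_t, ← map_mul, B.s_t_comm, map_mul]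
  Δ_mul_s := by
    intro l h u' hu'
    obtain ⟨l, rfl⟩ := D.f_surj l
    obtain ⟨h, rfl⟩ := D.φ_surj h
    obtain ⟨u, hu, rfl⟩ := D.exists_rep h u' hu'
    rw [← D.map_s, ← map_mul, D.map_Δ _ _ (B.Δ_mul_s l h u hu).symm, tensorMap_mul]
    simp
  Δ_mul_t := by
    intro l h u' hu'
    obtain ⟨l, rfl⟩ := D.f_surj l
    obtain ⟨h, rfl⟩ := D.φ_surj h
    obtain ⟨u, hu, rfl⟩ := D.exists_rep h u' hu'
    rw [← D.map_t, ← map_mul, D.map_Δ _ _ (B.Δ_mul_t l h u hu).symm, tensorMap_mul]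
    simp
  ε_mul_s := by
    intro l h
    obtain ⟨l, rfl⟩ := D.f_surj l
    obtain ⟨h, rfl⟩ := D.φ_surj h
    rw [← D.map_s, ← map_mul, D.map_ε, B.ε_mul_s, map_mul, D.map_ε]
  ε_mul_t := by
    intro l h
    obtain ⟨l, rfl⟩ := D.f_surj l
    obtain ⟨h, rfl⟩ := D.φ_surj h
    rw [← D.map_t, ← map_mul, D.map_ε, B.ε_mul_t, map_mul, D.map_ε]
  coassoc := by
    intro h u' hu'
    obtain ⟨h, rfl⟩ := D.φ_surj h
    obtain ⟨u, hu, rfl⟩ := D.exists_rep h u' hu'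
    rw [tensorMap_tensorMap_left D.map_Δ', tensorMap_tensorMap_right D.map_Δ',
      balancedOfLeft_map f f _ _ _ D.map_mulRight_s D.map_mulRight_t
        D.map_mulRight_s D.map_mulRight_t,
      balancedOfRight_map f f _ _ _ D.map_mulRight_s D.map_mulRight_t
        D.map_mulRight_s D.map_mulRight_t, B.coassoc h u hu]
  counit_left := by
    intro h u' hu'
    obtain ⟨h, rfl⟩ := D.φ_surj h
    obtain ⟨u, hu, rfl⟩ := D.exists_rep h u' hu'
    rw [tensorMap_tensorMap_left (T := B.t.toLinearMap ∘ₗ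
        (opLinearEquiv k : L ≃ₗ[k] Lᵐᵒᵖ).toLinearMap ∘ₗ B.ε) (F := φ.toLinearMap)
      (fun m => by simp [D.map_ε, D.map_t]), comm_tensorMap, mul'_tensorMap,
      B.counit_left h u hu]
  counit_right := by
    intro h u' hu'
    obtain ⟨h, rfl⟩ := D.φ_surj h
    obtain ⟨u, hu, rfl⟩ := D.exists_rep h u' hu'
    rw [tensorMap_tensorMap_right (T := B.s.toLinearMap ∘ₗ B.ε) (F := φ.toLinearMap)
      (fun m => by simp [D.map_ε, D.map_s]), mul'_tensorMap, B.counit_right h u hu]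
  takeuchi := by
    intro h u' hu' l
    obtain ⟨l, rfl⟩ := D.f_surj l
    obtain ⟨h, rfl⟩ := D.φ_surj h
    obtain ⟨u, hu, rfl⟩ := D.exists_rep h u' hu'
    have := congrArg (balancedMap (ρ' := fun r => LinearMap.mulRight k (D.s r))
      (σ' := fun r => LinearMap.mulRight k (D.t (op r))) f φ.toLinearMap φ.toLinearMap
      D.map_mulRight_s D.map_mulRight_t) (B.takeuchi h u hu l)
    simpa only [balancedMap_mk, tensorMap_mul, TensorProduct.map_tmul, AlgHom.toLinearMap_apply,
      map_one, D.map_s, D.map_t] using this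
  Δ_one := by
    rw [← map_one φ, D.map_Δ _ _ B.Δ_one.symm]
    simp
  Δ_mul := by
    intro h₁ h₂ u₁' u₂' hu₁' hu₂'
    obtain ⟨h₁, rfl⟩ := D.φ_surj h₁
    obtain ⟨h₂, rfl⟩ := D.φ_surj h₂
    obtain ⟨u₁, hu₁, rfl⟩ := D.exists_rep _ _ hu₁'
    obtain ⟨u₂, hu₂, rfl⟩ := D.exists_rep _ _ hu₂'
    rw [← map_mul, D.map_Δ _ _ (B.Δ_mul _ _ _ _ hu₁ hu₂).symm, tensorMap_mul]
  ε_one := by rw [← map_one φ, D.map_ε, B.ε_one, map_one]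
  ε_mul := by
    intro h₁ h₂
    obtain ⟨h₁, rfl⟩ := D.φ_surj h₁
    obtain ⟨h₂, rfl⟩ := D.φ_surj h₂
    rw [D.map_ε, ← D.map_s, ← map_mul, ← map_mul, D.map_ε, D.map_ε, B.ε_mul]

end RightBialgebroid.DescentData

variable {R R' : Type*} [Ring R] [Algebra k R] [Ring R'] [Algebra k R']

/-- Quotient of a Hopf algebroid by compatible data. -/
def HopfAlgebroid.descend (𝓗 : HopfAlgebroid k L R H) {fL : L →ₐ[k] L'} {fR : R →ₐ[k] R'}
    {φ : H →ₐ[k] H'} (DL : 𝓗.left.DescentData fL φ) (DR : 𝓗.right.DescentData fR φ)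
    (S : H' ≃ₗ[k] H') (map_S : ∀ h, S (φ h) = φ (𝓗.S h)) : HopfAlgebroid k L' R' H' where
  left := DL.toLeftBialgebroid
  right := DR.toRightBialgebroid
  S := S
  sL_εL_tR r := by
    obtain ⟨r, rfl⟩ := DR.f_surj r
    change DL.s (DL.ε (DR.t _)) = DR.t _
    rw [← DR.map_t, DL.map_ε, ← DL.map_s, 𝓗.sL_εL_tR]
  tR_εR_sL l := by
    obtain ⟨l, rfl⟩ := DL.f_surj l
    change DR.t (op (DR.ε (DL.s _))) = DL.s _
    rw [← DL.map_s, DR.map_ε, ← DR.map_t, 𝓗.tR_εR_sL]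
  tL_εL_sR r := by
    obtain ⟨r, rfl⟩ := DR.f_surj r
    change DL.t (op (DL.ε (DR.s _))) = DR.s _
    rw [← DR.map_s, DL.map_ε, ← DL.map_t, 𝓗.tL_εL_sR]
  sR_εR_tL l := by
    obtain ⟨l, rfl⟩ := DL.f_surj l
    change DR.s (DR.ε (DL.t _)) = DL.t _
    rw [← DL.map_t, DR.map_ε, ← DR.map_s, 𝓗.sR_εR_tL]
  coassoc_LR h u' v' hu' hv' := by
    obtain ⟨h, rfl⟩ := DR.φ_surj h
    obtain ⟨u, hu, rfl⟩ := DR.exists_rep h u' hu'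
    obtain ⟨v, hv, rfl⟩ := DL.exists_rep h v' hv'
    change balancedOfLeft k (fun l : L' => LinearMap.mulLeft k (DL.t (op l)))
        (fun l : L' => LinearMap.mulLeft k (DL.s l))
        (fun r : R' => LinearMap.mulRight k (DR.s r))
        (fun r : R' => LinearMap.mulRight k (DR.t (op r)))
        (TensorProduct.map DL.Δ LinearMap.id _) =
      balancedOfRight k (fun l : L' => LinearMap.mulLeft k (DL.t (op l)))
        (fun l : L' => LinearMap.mulLeft k (DL.s l))
        (fun r : R' => LinearMap.mulRight k (DR.s r))
        (fun r : R' => LinearMap.mulRight k (DR.t (op r)))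
        (TensorProduct.map LinearMap.id DR.Δ _)
    rw [tensorMap_tensorMap_left DL.map_Δ', tensorMap_tensorMap_right DR.map_Δ',
      balancedOfLeft_map fL fR _ _ _ DL.map_mulLeft_t DL.map_mulLeft_s
        DR.map_mulRight_s DR.map_mulRight_t,
      balancedOfRight_map fL fR _ _ _ DL.map_mulLeft_t DL.map_mulLeft_s
        DR.map_mulRight_s DR.map_mulRight_t, 𝓗.coassoc_LR h u v hu hv]
  coassoc_RL h u' v' hu' hv' := by
    obtain ⟨h, rfl⟩ := DR.φ_surj h
    obtain ⟨u, hu, rfl⟩ := DL.exists_rep h u' hu'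
    obtain ⟨v, hv, rfl⟩ := DR.exists_rep h v' hv'
    change balancedOfLeft k (fun r : R' => LinearMap.mulRight k (DR.s r))
        (fun r : R' => LinearMap.mulRight k (DR.t (op r)))
        (fun l : L' => LinearMap.mulLeft k (DL.t (op l)))
        (fun l : L' => LinearMap.mulLeft k (DL.s l))
        (TensorProduct.map DR.Δ LinearMap.id _) =
      balancedOfRight k (fun r : R' => LinearMap.mulRight k (DR.s r))
        (fun r : R' => LinearMap.mulRight k (DR.t (op r)))
        (fun l : L' => LinearMap.mulLeft k (DL.t (op l)))
        (fun l : L' => LinearMap.mulLeft k (DL.s l))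
        (TensorProduct.map LinearMap.id DL.Δ _)
    rw [tensorMap_tensorMap_left DR.map_Δ', tensorMap_tensorMap_right DL.map_Δ',
      balancedOfLeft_map fR fL _ _ _ DR.map_mulRight_s DR.map_mulRight_t
        DL.map_mulLeft_t DL.map_mulLeft_s,
      balancedOfRight_map fR fL _ _ _ DR.map_mulRight_s DR.map_mulRight_t
        DL.map_mulLeft_t DL.map_mulLeft_s, 𝓗.coassoc_RL h u v hu hv]
  S_mul l r h := by
    obtain ⟨l, rfl⟩ := DL.f_surj l
    obtain ⟨r, rfl⟩ := DR.f_surj r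
    obtain ⟨h, rfl⟩ := DR.φ_surj h
    change S (DL.t _ * _ * DR.t _) = DR.s _ * _ * DL.s _
    rw [← DL.map_t, ← DR.map_t, ← DR.map_s, ← DL.map_s, map_S, ← map_mul, ← map_mul, map_S,
      𝓗.S_mul, map_mul, map_mul]
  antipode_left h u' hu' := by
    obtain ⟨h, rfl⟩ := DL.φ_surj h
    obtain ⟨u, hu, rfl⟩ := DL.exists_rep h u' hu'
    change _ = DR.s (DR.ε _)
    rw [tensorMap_tensorMap_left (T := 𝓗.S.toLinearMap) (F := φ.toLinearMap) map_S,
      mul'_tensorMap, 𝓗.antipode_left h u hu, DR.map_s, DR.map_ε]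
  antipode_right h u' hu' := by
    obtain ⟨h, rfl⟩ := DR.φ_surj h
    obtain ⟨u, hu, rfl⟩ := DR.exists_rep h u' hu'
    change _ = DL.s (DL.ε _)
    rw [tensorMap_tensorMap_right (T := 𝓗.S.toLinearMap) (F := φ.toLinearMap) map_S,
      mul'_tensorMap, 𝓗.antipode_right h u hu, DL.map_s, DL.map_ε]

theorem HopfAlgebroid.descend_isGeometricMorphism (𝓗 : HopfAlgebroid k L R H) {fL : L →ₐ[k] L'}
    {fR : R →ₐ[k] R'} {φ : H →ₐ[k] H'} (DL : 𝓗.left.DescentData fL φ)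
    (DR : 𝓗.right.DescentData fR φ) (S : H' ≃ₗ[k] H') (map_S : ∀ h, S (φ h) = φ (𝓗.S h)) :
    𝓗.IsGeometricMorphism (𝓗.descend DL DR S map_S) fL fR φ where
  sL := DL.map_s
  tL := DL.map_t
  εL h := (DL.map_ε h).symm
  sR := DR.map_s
  tR := DR.map_t
  εR h := (DR.map_ε h).symm
  ΔL := DL.map_Δ
  ΔR := DR.map_Δ
  S h := (map_S h).symm

/-- The linear map on the target of a surjection `φ` induced by a map vanishing on `ker φ`. -/
def LinearMap.descend {M N P : Type*} [AddCommGroup M] [Module k M] [AddCommGroup N] [Module k N]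
    [AddCommGroup P] [Module k P] (φ : M →ₗ[k] N) (hφ : Function.Surjective φ) (T : M →ₗ[k] P)
    (hT : LinearMap.ker φ ≤ LinearMap.ker T) : N →ₗ[k] P :=
  (LinearMap.ker φ).liftQ T hT ∘ₗ (φ.quotKerEquivOfSurjective hφ).symm.toLinearMap

theorem LinearMap.descend_apply {M N P : Type*} [AddCommGroup M] [Module k M] [AddCommGroup N]
    [Module k N] [AddCommGroup P] [Module k P] (φ : M →ₗ[k] N) (hφ : Function.Surjective φ)
    (T : M →ₗ[k] P) (hT : LinearMap.ker φ ≤ LinearMap.ker T) (m : M) :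
    LinearMap.descend φ hφ T hT (φ m) = T m := by
  have : (φ.quotKerEquivOfSurjective hφ).symm (φ m) = Submodule.Quotient.mk m := by
    rw [LinearEquiv.symm_apply_eq]
    rfl
  simp only [LinearMap.descend, LinearMap.comp_apply, LinearEquiv.coe_coe, this]
  rfl

end Descent

/-! ### Families of vector spaces with a finite continuous frame of generators -/

/-- Finitely many sections `b j` of a family `E` of complex vector spaces and coefficient maps
`c x` with `v = ∑ j, c x v j • b j x`, such that the coefficients of the `b j` are continuous. -/
structure GeneratingFrame {X : Type*} [TopologicalSpace X] (E : X → Type*)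
    [∀ x, AddCommGroup (E x)] [∀ x, Module ℂ (E x)] (n : ℕ) where
  b : Fin n → ∀ x, E x
  c : ∀ x, E x →ₗ[ℂ] (Fin n → ℂ)
  sum_c_smul_b : ∀ x (v : E x), ∑ j, c x v j • b j x = v
  continuous_c_b : ∀ j, Continuous fun x => c x (b j x)

namespace GeneratingFrame

variable {X : Type*} [TopologicalSpace X] {E : X → Type*}
    [∀ x, AddCommGroup (E x)] [∀ x, Module ℂ (E x)] {n : ℕ} (F : GeneratingFrame E n)

/-- Linear combinations of the generators of the fibre over `x`. -/
def π (x : X) : (Fin n → ℂ) →ₗ[ℂ] E x := Fintype.linearCombination ℂ (fun j => F.b j x)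

theorem π_apply (x : X) (w : Fin n → ℂ) : F.π x w = ∑ j, w j • F.b j x := rfl

theorem π_c (x : X) (v : E x) : F.π x (F.c x v) = v := F.sum_c_smul_b x v

/-- The idempotent matrix of the projection onto the image of the fibre over `x`. -/
def e (x : X) : Matrix (Fin n) (Fin n) ℂ := Matrix.of fun i j => F.c x (F.b j x) i

theorem e_mulVec (x : X) (w : Fin n → ℂ) : (F.e x).mulVec w = F.c x (F.π x w) := by
  ext i
  simp [π_apply, e, Matrix.mulVec, dotProduct, map_sum, mul_comm]

/-- `e x` is the matrix of `c x ∘ π x`, and `π x ∘ c x = id`. -/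
theorem e_mul_self (x : X) : F.e x * F.e x = F.e x := by
  refine Matrix.ext_of_mulVec_single fun j => ?_
  rw [← Matrix.mulVec_mulVec, e_mulVec, e_mulVec, π_c]

theorem continuous_e : Continuous F.e :=
  continuous_matrix fun i j => (continuous_apply i).comp (F.continuous_c_b j)

/-- A matrix which intertwines the projections `e x` and `e x₀`. -/
def g (x₀ x : X) : Matrix (Fin n) (Fin n) ℂ :=
  F.e x₀ * F.e x + (1 - F.e x₀) * (1 - F.e x)

theorem g_self (x : X) : F.g x x = 1 := by
  simp only [g, mul_sub, sub_mul, F.e_mul_self, one_mul, mul_one]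
  abel

theorem continuous_g (x₀ : X) : Continuous (F.g x₀) := by
  have := F.continuous_e
  unfold g
  fun_prop

/-- Together with `g_mul_e` this gives `e x₀ * g = g * e x`: where `g` is invertible it maps the
range of `e x` isomorphically onto that of `e x₀`. -/
theorem e_mul_g (x₀ x : X) : F.e x₀ * F.g x₀ x = F.e x₀ * F.e x := by
  simp only [g, mul_add, ← mul_assoc, F.e_mul_self, mul_sub, mul_one, sub_self, zero_mul, add_zero]

theorem g_mul_e (x₀ x : X) : F.g x₀ x * F.e x = F.e x₀ * F.e x := by
  simp only [g, add_mul, mul_assoc, F.e_mul_self, sub_mul, one_mul, sub_self, mul_zero, add_zero]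

theorem π_e (x : X) (w : Fin n → ℂ) : F.π x ((F.e x).mulVec w) = F.π x w := by
  rw [e_mulVec, π_c]

theorem e_c (x : X) (v : E x) : (F.e x).mulVec (F.c x v) = F.c x v := by
  rw [e_mulVec, π_c]

/-- The set of points over which the bundle is identified with its fibre over `x₀`. -/
def nhd (x₀ : X) : Set X := {x | (F.g x₀ x).det ≠ 0}

theorem isOpen_nhd (x₀ : X) : IsOpen (F.nhd x₀) :=
  isOpen_ne_fun (F.continuous_g x₀).matrix_det continuous_const

theorem mem_nhd_self (x₀ : X) : x₀ ∈ F.nhd x₀ := by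
  simp [nhd, g_self]

/-- With fibres viewed as ranges of the idempotents, `v ↦ π x₀ (c x v)` is multiplication by `g x₀
x`, because `g * e x = e x₀ * e x`. Hence `g⁻¹` undoes it. -/
theorem transport_left_inv (x₀ x : X) (hx : x ∈ F.nhd x₀) (v : E x) :
    F.π x ((F.g x₀ x)⁻¹.mulVec (F.c x₀ (F.π x₀ (F.c x v)))) = v := by
  have h : F.c x₀ (F.π x₀ (F.c x v)) = (F.g x₀ x).mulVec (F.c x v) := by
    rw [← F.e_mulVec, ← F.e_c x v, Matrix.mulVec_mulVec, Matrix.mulVec_mulVec, g_mul_e]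
  rw [h, Matrix.mulVec_mulVec, Matrix.nonsing_inv_mul _ (IsUnit.mk0 _ hx), Matrix.one_mulVec, π_c]

/-- The mirror computation, now with `e x₀ * g = e x₀ * e x`. -/
theorem transport_right_inv (x₀ x : X) (hx : x ∈ F.nhd x₀) (w : E x₀) :
    F.π x₀ (F.c x (F.π x ((F.g x₀ x)⁻¹.mulVec (F.c x₀ w)))) = w := by
  rw [← F.e_mulVec, ← F.π_e x₀, Matrix.mulVec_mulVec, Matrix.mulVec_mulVec, ← e_mul_g,
    mul_assoc, Matrix.mul_nonsing_inv _ (IsUnit.mk0 _ hx), mul_one, π_e, π_c]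

/-! ### Topology of the total space and local triviality -/

/-- The total space as a subset of the trivial bundle. -/
def toProd (p : Bundle.TotalSpace Unit E) : X × (Fin n → ℂ) := (p.proj, F.c p.proj p.snd)

/-- The topology of the total space as a subspace of the trivial bundle. -/
abbrev topology : TopologicalSpace (Bundle.TotalSpace Unit E) :=
  TopologicalSpace.induced F.toProd inferInstance

theorem continuous_proj :
    Continuous[F.topology, _] (Bundle.TotalSpace.proj : Bundle.TotalSpace Unit E → X) := by
  let := F.topology
  exact continuous_fst.comp (continuous_induced_dom (f := F.toProd))

theorem continuous_coeff :
    Continuous[F.topology, _] fun p : Bundle.TotalSpace Unit E => F.c p.proj p.snd := by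
  let := F.topology
  exact continuous_snd.comp (continuous_induced_dom (f := F.toProd))

theorem continuousOn_rng {Y : Type*} [TopologicalSpace Y] {f : Y → Bundle.TotalSpace Unit E}
    {U : Set Y} (h₁ : ContinuousOn (fun y => (f y).proj) U)
    (h₂ : ContinuousOn (fun y => F.c (f y).proj (f y).snd) U) :
    letI := F.topology
    ContinuousOn f U := by
  let := F.topology
  exact (Topology.IsInducing.continuousOn_iff ⟨rfl⟩ : ContinuousOn f U ↔
    ContinuousOn (F.toProd ∘ f) U).2 (h₁.prodMk h₂)

theorem continuous_rng {Y : Type*} [TopologicalSpace Y] {f : Y → Bundle.TotalSpace Unit E}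
    (h₁ : Continuous (fun y => (f y).proj))
    (h₂ : Continuous (fun y => F.c (f y).proj (f y).snd)) :
    Continuous[_, F.topology] f := by
  let := F.topology
  exact continuous_induced_rng.2 (h₁.prodMk h₂)

theorem continuousOn_mulVec {Y : Type*} [TopologicalSpace Y] {A : Y → Matrix (Fin n) (Fin n) ℂ}
    {w : Y → Fin n → ℂ} {U : Set Y} (hA : ContinuousOn A U) (hw : ContinuousOn w U) :
    ContinuousOn (fun y => (A y).mulVec (w y)) U :=
  (continuous_fst.matrix_mulVec continuous_snd :
    Continuous fun z : Matrix (Fin n) (Fin n) ℂ × (Fin n → ℂ) => z.1.mulVec z.2).comp_continuousOn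
      (hA.prodMk hw)

/-- By Cramer's rule the inverse is the adjugate divided by the determinant, which does not vanish
on `nhd x₀`. -/
theorem continuousOn_inv_g (x₀ : X) : ContinuousOn (fun x => (F.g x₀ x)⁻¹) (F.nhd x₀) := by
  simp only [Matrix.inv_def, Ring.inverse_eq_inv']
  exact ((F.continuous_g x₀).matrix_det.continuousOn.inv₀ fun x hx => hx).smul
    (F.continuous_g x₀).matrix_adjugate.continuousOn

/-- In coordinates the inverse transport is `e x * g⁻¹`, because `c x ∘ π x` is `e x`. -/
theorem continuousOn_transport_inv {Y : Type*} [TopologicalSpace Y] (x₀ : X) {p : Y → X}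
    {w : Y → Fin n → ℂ} {U : Set Y} (hp : ContinuousOn p U) (hw : ContinuousOn w U)
    (hU : Set.MapsTo p U (F.nhd x₀)) :
    ContinuousOn (fun y => F.c (p y) (F.π (p y) ((F.g x₀ (p y))⁻¹.mulVec (w y)))) U := by
  simp only [← e_mulVec]
  exact continuousOn_mulVec (F.continuous_e.comp_continuousOn hp)
    (continuousOn_mulVec ((F.continuousOn_inv_g x₀).comp hp hU) hw)

theorem isFiniteRankVectorBundle :
    letI := F.topology
    IsFiniteRankVectorBundle E := by
  let := F.topology
  intro x₀
  have : FiniteDimensional ℂ (E x₀) :=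
    Module.Finite.of_surjective (F.π x₀) fun v => ⟨_, F.π_c x₀ v⟩
  -- The local rank is the dimension of `E x₀`, in general smaller than the number `n` of
  -- generators.
  let φ : E x₀ ≃ₗ[ℂ] (Fin (Module.finrank ℂ (E x₀)) → ℂ) :=
    (Module.finBasis ℂ (E x₀)).equivFun
  -- The chart transports a vector to `E x₀` and takes its coordinates there; its inverse transports
  -- back with `g⁻¹`.
  refine ⟨Module.finrank ℂ (E x₀), ⟨⟨⟨⟨
    fun p => (p.proj, φ (F.π x₀ (F.c p.proj p.snd))),
    fun q => ⟨q.1, F.π q.1 ((F.g x₀ q.1)⁻¹.mulVec (F.c x₀ (φ.symm q.2)))⟩,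
    Bundle.TotalSpace.proj ⁻¹' F.nhd x₀, F.nhd x₀ ×ˢ Set.univ, ?_, ?_, ?_, ?_⟩, ?_, ?_⟩, ?_, ?_⟩,
    F.nhd x₀, F.isOpen_nhd x₀, rfl, rfl, fun _ _ => rfl⟩, F.mem_nhd_self x₀, ?_⟩
  · exact fun p hp => ⟨hp, trivial⟩
  · exact fun q hq => hq.1
  · rintro ⟨x, v⟩ hx
    simp only [LinearEquiv.symm_apply_apply]
    rw [F.transport_left_inv x₀ x hx]
  · rintro ⟨x, w⟩ ⟨hx, -⟩
    simp only
    rw [F.transport_right_inv x₀ x hx, LinearEquiv.apply_symm_apply]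
  · have h : Continuous (φ.toLinearMap ∘ₗ F.π x₀) := LinearMap.continuous_of_finiteDimensional _
    exact (F.continuous_proj.prodMk (h.comp F.continuous_coeff)).continuousOn
  · have h : Continuous (F.c x₀ ∘ₗ φ.symm.toLinearMap) :=
      LinearMap.continuous_of_finiteDimensional _
    refine F.continuousOn_rng continuous_fst.continuousOn ?_
    exact F.continuousOn_transport_inv x₀ continuous_fst.continuousOn
      (h.comp continuous_snd).continuousOn fun q hq => hq.1
  · exact (F.isOpen_nhd x₀).preimage F.continuous_proj
  · exact (F.isOpen_nhd x₀).prod isOpen_univ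
  · intro x _
    exact (φ.toLinearMap ∘ₗ F.π x₀ ∘ₗ F.c x).isLinear

theorem sectionContinuousOn_iff (σ : ∀ x, E x) (U : Set X) :
    letI := F.topology
    SectionContinuousOn σ U ↔ ContinuousOn (fun x => F.c x (σ x)) U := by
  let := F.topology
  refine ⟨fun h => F.continuous_coeff.comp_continuousOn h, fun h => ?_⟩
  exact F.continuousOn_rng continuousOn_id h

theorem continuous_section_iff (σ : ∀ x, E x) :
    letI := F.topology
    Continuous (fun x => (Bundle.TotalSpace.mk x (σ x) : Bundle.TotalSpace Unit E)) ↔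
      Continuous (fun x => F.c x (σ x)) := by
  let := F.topology
  refine ⟨fun h => F.continuous_coeff.comp h, fun h => ?_⟩
  exact F.continuous_rng continuous_id h

/-! ### Continuity of fibrewise maps, tested on the generators -/

/-- Fibrewise linear functions with continuous values on the generators are continuous. -/
theorem continuous_linear {V : Type*} [AddCommGroup V] [Module ℂ V] [TopologicalSpace V]
    [ContinuousAdd V] [ContinuousSMul ℂ V] (T : ∀ x, E x →ₗ[ℂ] V)
    (hT : ∀ j, Continuous fun x => T x (F.b j x)) :
    letI := F.topology
    Continuous fun p : Bundle.TotalSpace Unit E => T p.proj p.snd := by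
  let := F.topology
  have : (fun p : Bundle.TotalSpace Unit E => T p.proj p.snd) =
      fun p => ∑ j, F.c p.proj p.snd j • T p.proj (F.b j p.proj) := by
    ext p
    conv_lhs => rw [← F.sum_c_smul_b p.proj p.snd]
    simp only [map_sum, map_smul]
  rw [this]
  exact continuous_finsetSum _ fun j _ =>
    ((continuous_apply j).comp F.continuous_coeff).smul ((hT j).comp F.continuous_proj)

/-- Fibrewise linear endomorphisms with continuous values on the generators are continuous. -/
theorem continuous_endomorphism (T : ∀ x, E x →ₗ[ℂ] E x)
    (hT : ∀ j, Continuous fun x => F.c x (T x (F.b j x))) :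
    letI := F.topology
    Continuous fun p : Bundle.TotalSpace Unit E =>
      (Bundle.TotalSpace.mk p.proj (T p.proj p.snd) : Bundle.TotalSpace Unit E) := by
  let := F.topology
  exact F.continuous_rng F.continuous_proj
    (F.continuous_linear (fun x => F.c x ∘ₗ T x) hT)

/-- Fibrewise bilinear products with continuous values on the generators are continuous. -/
theorem continuous_bilinear (T : ∀ x, E x →ₗ[ℂ] E x →ₗ[ℂ] E x)
    (hT : ∀ i j, Continuous fun x => F.c x (T x (F.b i x) (F.b j x))) :
    Continuous[TopologicalSpace.induced
      (fun p : Bundle.TotalSpace Unit (fun x => E x × E x) =>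
        ((Bundle.TotalSpace.mk p.proj p.snd.1 : Bundle.TotalSpace Unit E),
          (Bundle.TotalSpace.mk p.proj p.snd.2 : Bundle.TotalSpace Unit E)))
      (@instTopologicalSpaceProd _ _ F.topology F.topology), F.topology]
      fun p => Bundle.TotalSpace.mk p.proj (T p.proj p.snd.1 p.snd.2) := by
  let := F.topology
  let : TopologicalSpace (Bundle.TotalSpace Unit (fun x => E x × E x)) :=
    TopologicalSpace.induced
      (fun p : Bundle.TotalSpace Unit (fun x => E x × E x) =>
        ((Bundle.TotalSpace.mk p.proj p.snd.1 : Bundle.TotalSpace Unit E),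
          (Bundle.TotalSpace.mk p.proj p.snd.2 : Bundle.TotalSpace Unit E))) inferInstance
  have h : Continuous (fun p : Bundle.TotalSpace Unit (fun x => E x × E x) =>
        ((Bundle.TotalSpace.mk p.proj p.snd.1 : Bundle.TotalSpace Unit E),
          (Bundle.TotalSpace.mk p.proj p.snd.2 : Bundle.TotalSpace Unit E))) :=
    continuous_induced_dom
  have hp : Continuous fun p : Bundle.TotalSpace Unit (fun x => E x × E x) => p.proj :=
    F.continuous_proj.comp h.fst
  have h₁ : Continuous fun p : Bundle.TotalSpace Unit (fun x => E x × E x) =>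
      F.c p.proj p.snd.1 := F.continuous_coeff.comp h.fst
  have h₂ : Continuous fun p : Bundle.TotalSpace Unit (fun x => E x × E x) =>
      F.c p.proj p.snd.2 := F.continuous_coeff.comp h.snd
  refine F.continuous_rng hp ?_
  have : (fun p : Bundle.TotalSpace Unit (fun x => E x × E x) =>
      F.c p.proj (T p.proj p.snd.1 p.snd.2)) = fun p => ∑ j, F.c p.proj p.snd.2 j •
        ∑ i, F.c p.proj p.snd.1 i • F.c p.proj (T p.proj (F.b i p.proj) (F.b j p.proj)) := by
    ext1 p
    conv_lhs => rw [← F.sum_c_smul_b p.proj p.snd.1, ← F.sum_c_smul_b p.proj p.snd.2]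
    simp only [map_sum, map_smul, LinearMap.sum_apply, LinearMap.smul_apply]
  change Continuous fun p : Bundle.TotalSpace Unit (fun x => E x × E x) =>
      F.c p.proj (T p.proj p.snd.1 p.snd.2)
  rw [this]
  exact continuous_finsetSum _ fun j _ => ((continuous_apply j).comp h₂).smul
    (continuous_finsetSum _ fun i _ => ((continuous_apply i).comp h₁).smul ((hT i j).comp hp))

/-- Fibrewise linear maps into (quotients of) the tensor square which send generators to tensors
of continuous sections map continuous sections to continuous sections. -/
theorem tensorSectionContinuousOn {Q : ∀ x, Submodule ℂ (E x ⊗[ℂ] E x)}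
    (T : ∀ x, E x →ₗ[ℂ] (E x ⊗[ℂ] E x) ⧸ Q x) {m : Fin n → ℕ}
    {a d : ∀ j, Fin (m j) → ∀ x, E x}
    (ha : ∀ j i, Continuous fun x => F.c x (a j i x))
    (hd : ∀ j i, Continuous fun x => F.c x (d j i x))
    (hT : ∀ x j, T x (F.b j x) = Submodule.Quotient.mk (∑ i, a j i x ⊗ₜ[ℂ] d j i x))
    (U : Set X) (σ : ∀ x, E x) :
    letI := F.topology
    SectionContinuousOn σ U → TensorSectionContinuousOn Q (fun x => T x (σ x)) U := by
  let := F.topology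
  intro hσ x₀ _
  rw [F.sectionContinuousOn_iff] at hσ
  -- Expanding `σ x` in the generators gives a double sum over `j` and `i`, reindexed here as one
  -- finite sum; the coefficient of `b j` goes into the left factor. The expression is global, so
  -- the neighbourhood is all of `X`.
  let eqv : Fin (Fintype.card (Σ j, Fin (m j))) ≃ Σ j, Fin (m j) := (Fintype.equivFin _).symm
  refine ⟨Set.univ, isOpen_univ, trivial, _,
    fun i x => F.c x (σ x) (eqv i).1 • a (eqv i).1 (eqv i).2 x,
    fun i x => d (eqv i).1 (eqv i).2 x, fun i => ?_, fun i => ?_, fun x _ => ?_⟩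
  · rw [Set.univ_inter, F.sectionContinuousOn_iff]
    simp only [map_smul]
    exact ((continuous_apply _).comp_continuousOn hσ).smul (ha _ _).continuousOn
  · rw [F.sectionContinuousOn_iff]
    exact (hd _ _).continuousOn
  · rw [eqv.sum_comp (fun s : Σ j, Fin (m j) =>
      (F.c x (σ x) s.1 • a s.1 s.2 x) ⊗ₜ[ℂ] d s.1 s.2 x), Fintype.sum_sigma]
    change T x (σ x) = _
    conv_lhs => rw [← F.sum_c_smul_b x (σ x)]
    simp only [map_sum, map_smul, hT, ← Submodule.mkQ_apply, Finset.smul_sum]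
    simp only [← TensorProduct.smul_tmul', map_smul]

end GeneratingFrame

/-! ### Fibres of algebras over `C(X, ℂ)` -/

section Fiber

variable {X : Type*} [TopologicalSpace X] {H : Type*} [Ring H] [Algebra ℂ H]
  (s : C(X, ℂ) →ₐ[ℂ] H)

/-- The ideal generated by the functions vanishing at `x`. -/
def fiberIdeal (x : X) : Ideal H := Ideal.span {h | ∃ f : C(X, ℂ), f x = 0 ∧ s f = h}

variable {s}

theorem map_mem_fiberIdeal {x : X} {f : C(X, ℂ)} (hf : f x = 0) : s f ∈ fiberIdeal s x :=
  Ideal.subset_span ⟨f, hf, rfl⟩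

/-- The ideal is a left ideal by definition; its generators are central, so right multiples of them
are left multiples. -/
theorem fiberIdeal_isTwoSided (hs : ∀ f h, s f * h = h * s f) (x : X) :
    (fiberIdeal s x).IsTwoSided where
  mul_mem_of_left {h} b hh := by
    refine Submodule.span_induction (p := fun h _ => h * b ∈ fiberIdeal s x) ?_ ?_ ?_ ?_ hh
    · rintro _ ⟨f, hf, rfl⟩
      rw [hs]
      exact Ideal.mul_mem_left _ _ (map_mem_fiberIdeal hf)
    · simp
    · intro h h' _ _ h₁ h₂
      rw [add_mul]
      exact add_mem h₁ h₂
    · intro a h _ h₁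
      rw [smul_eq_mul, mul_assoc]
      exact Ideal.mul_mem_left _ _ h₁

/-- By centrality the ideal consists of sums of elements `s f * h` with `f x = 0`. This is the
criterion by which every structure map descends to the fibre. -/
theorem eq_zero_of_mem_fiberIdeal (hs : ∀ f h, s f * h = h * s f) {M : Type*} [AddCommGroup M]
    [Module ℂ M] {x : X} (T : H →ₗ[ℂ] M) (hT : ∀ f h, f x = 0 → T (s f * h) = 0) {h : H}
    (hh : h ∈ fiberIdeal s x) : T h = 0 := by
  -- The extra left factor `a` lets the induction absorb multiplication by ring elements, for which
  -- `T` is not linear.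
  suffices ∀ a, T (a * h) = 0 by simpa using this 1
  refine Submodule.span_induction (p := fun h _ => ∀ a, T (a * h) = 0) ?_ ?_ ?_ ?_ hh
  · rintro _ ⟨f, hf, rfl⟩ a
    rw [← hs, hT f a hf]
  · simp
  · intro h h' _ _ h₁ h₂ a
    rw [mul_add, map_add, h₁, h₂, add_zero]
  · intro r h _ h₁ a
    rw [smul_eq_mul, ← mul_assoc, h₁]

variable {x : X} {E : Type*} [Ring E] [Algebra ℂ E] {φ : H →ₐ[ℂ] E}

/-- `f - f x` vanishes at `x`. Thus functions act on the fibre as scalars, and the base algebras of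
the fibre become `ℂ`. -/
theorem map_eq_algebraMap (hker : ∀ h, φ h = 0 ↔ h ∈ fiberIdeal s x) (f : C(X, ℂ)) :
    φ (s f) = algebraMap ℂ E (f x) := by
  have h : φ (s (f - algebraMap ℂ C(X, ℂ) (f x))) = 0 :=
    (hker _).2 (map_mem_fiberIdeal (by simp))
  rw [map_sub, map_sub, AlgHom.commutes, AlgHom.commutes, sub_eq_zero] at h
  exact h

theorem ker_le_ker_of_fiber (hs : ∀ f h, s f * h = h * s f)
    (hker : ∀ h, φ h = 0 ↔ h ∈ fiberIdeal s x) {M : Type*} [AddCommGroup M]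
    [Module ℂ M] (T : H →ₗ[ℂ] M) (hT : ∀ f h, f x = 0 → T (s f * h) = 0) :
    LinearMap.ker φ.toLinearMap ≤ LinearMap.ker T := fun h hh =>
  eq_zero_of_mem_fiberIdeal hs T hT ((hker h).1 hh)

/-- The linear map on the fibre induced by a map vanishing on multiples of functions vanishing
at the point. -/
def fiberLift (hs : ∀ f h, s f * h = h * s f) (hφ : Function.Surjective φ)
    (hker : ∀ h, φ h = 0 ↔ h ∈ fiberIdeal s x) {M : Type*} [AddCommGroup M]
    [Module ℂ M] (T : H →ₗ[ℂ] M) (hT : ∀ f h, f x = 0 → T (s f * h) = 0) : E →ₗ[ℂ] M :=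
  LinearMap.descend φ.toLinearMap hφ T (ker_le_ker_of_fiber hs hker T hT)

theorem fiberLift_apply (hs : ∀ f h, s f * h = h * s f) (hφ : Function.Surjective φ)
    (hker : ∀ h, φ h = 0 ↔ h ∈ fiberIdeal s x) {M : Type*} [AddCommGroup M]
    [Module ℂ M] (T : H →ₗ[ℂ] M) (hT : ∀ f h, f x = 0 → T (s f * h) = 0) (h : H) :
    fiberLift hs hφ hker T hT (φ h) = T h :=
  LinearMap.descend_apply φ.toLinearMap hφ T _ h

/-- The unit map `ℂᵐᵒᵖ → E` of a complex algebra. -/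
def opUnit (E : Type*) [Ring E] [Algebra ℂ E] : ℂᵐᵒᵖ →ₐ[ℂ] E :=
  (Algebra.ofId ℂ E).comp (AlgEquiv.toOpposite ℂ ℂ).symm.toAlgHom

theorem opUnit_op (z : ℂ) : opUnit E (op z) = algebraMap ℂ E z := rfl

variable {L : Type*} [Ring L] [Algebra ℂ L]

theorem algHom_complex_surjective (f : L →ₐ[ℂ] ℂ) : Function.Surjective f := fun z =>
  ⟨algebraMap ℂ L z, by simp⟩

/-- A left bialgebroid whose source and target factor through `C(X, ℂ)` descends to the fibres. -/
def LeftBialgebroid.fiberDescent (B : LeftBialgebroid ℂ L H) (θ : L →ₐ[ℂ] C(X, ℂ))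
    (hθ : Function.Surjective θ) (hBs : ∀ l, B.s l = s (θ l)) (hBt : ∀ l, B.t (op l) = s (θ l))
    (hs : ∀ f h, s f * h = h * s f) (hφ : Function.Surjective φ)
    (hker : ∀ h, φ h = 0 ↔ h ∈ fiberIdeal s x) :
    B.DescentData ((ContinuousMap.evalAlgHom ℂ ℂ x).comp θ) φ :=
  let T : H →ₗ[ℂ] BalancedTensor ℂ (fun z : ℂ => LinearMap.mulLeft ℂ (opUnit E (op z)))
      (fun z : ℂ => LinearMap.mulLeft ℂ (Algebra.ofId ℂ E z)) :=
    balancedMap ((ContinuousMap.evalAlgHom ℂ ℂ x).comp θ) φ.toLinearMap φ.toLinearMap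
      (fun l h => by
        simp [hBt, map_eq_algebraMap hker, opUnit_op])
      (fun l h => by
        simp [hBs, map_eq_algebraMap hker, Algebra.ofId_apply]) ∘ₗ B.Δ
  -- With `f = θ l`, left linearity of `Δ` puts `s l` in the first tensor factor, where `φ` turns it
  -- into the scalar `f x = 0`.
  have hT : ∀ f h, f x = 0 → T (s f * h) = 0 := fun f h hf => by
    obtain ⟨l, rfl⟩ := hθ f
    obtain ⟨u, hu⟩ := Submodule.Quotient.mk_surjective _ (B.Δ h)
    simp only [T, LinearMap.comp_apply]
    rw [← hBs, B.Δ_s_mul l h u hu, balancedMap_mk, tensorMap_mul, TensorProduct.map_tmul,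
      AlgHom.toLinearMap_apply, hBs, map_eq_algebraMap hker, hf, map_zero,
      TensorProduct.zero_tmul, zero_mul, Submodule.Quotient.mk_zero]
  have hε : ∀ f h, f x = 0 →
      (((ContinuousMap.evalAlgHom ℂ ℂ x).comp θ).toLinearMap ∘ₗ B.ε) (s f * h) = 0 :=
    fun f h hf => by
      obtain ⟨l, rfl⟩ := hθ f
      simp [← hBs, B.ε_s_mul, hf]
  { f_surj := algHom_complex_surjective _
    φ_surj := hφ
    s := Algebra.ofId ℂ E
    t := opUnit E
    Δ := fiberLift hs hφ hker T hT
    ε := fiberLift hs hφ hker _ hε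
    map_s := fun l => by rw [hBs, map_eq_algebraMap hker]; rfl
    map_t := fun l => by rw [hBt, map_eq_algebraMap hker]; rfl
    map_Δ := fun h u hu => by
      refine (fiberLift_apply hs hφ hker T hT h).trans ?_
      simp only [T, LinearMap.comp_apply]
      rw [← hu, balancedMap_mk]
    map_ε := fun h => fiberLift_apply hs hφ hker _ hε h }

/-- A right bialgebroid over `C(X, ℂ)` with equal central source and target descends to the
fibres. -/
def RightBialgebroid.fiberDescent (B : RightBialgebroid ℂ C(X, ℂ) H)
    (hBt : ∀ f, B.t (op f) = B.s f)
    (hs : ∀ f h, B.s f * h = h * B.s f) (hφ : Function.Surjective φ)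
    (hker : ∀ h, φ h = 0 ↔ h ∈ fiberIdeal B.s x) :
    B.DescentData (ContinuousMap.evalAlgHom ℂ ℂ x) φ :=
  let T : H →ₗ[ℂ] BalancedTensor ℂ (fun z : ℂ => LinearMap.mulRight ℂ (Algebra.ofId ℂ E z))
      (fun z : ℂ => LinearMap.mulRight ℂ (opUnit E (op z))) :=
    balancedMap (ContinuousMap.evalAlgHom ℂ ℂ x) φ.toLinearMap φ.toLinearMap
      (fun l h => by
        simp [map_eq_algebraMap hker, Algebra.ofId_apply])
      (fun l h => by
        simp [hBt, map_eq_algebraMap hker, opUnit_op]) ∘ₗ B.Δ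
  -- A right coproduct is linear for right multiplication, so centrality first moves `s f` to the
  -- right; it then lands in the second factor as `f x = 0`.
  have hT : ∀ f h, f x = 0 → T (B.s f * h) = 0 := fun f h hf => by
    obtain ⟨u, hu⟩ := Submodule.Quotient.mk_surjective _ (B.Δ h)
    simp only [T, LinearMap.comp_apply]
    rw [hs, B.Δ_mul_s f h u hu, balancedMap_mk, tensorMap_mul, TensorProduct.map_tmul,
      AlgHom.toLinearMap_apply, AlgHom.toLinearMap_apply, map_eq_algebraMap hker, hf, map_zero,
      TensorProduct.tmul_zero, mul_zero, Submodule.Quotient.mk_zero]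
  have hε : ∀ f h, f x = 0 →
      ((ContinuousMap.evalAlgHom ℂ ℂ x).toLinearMap ∘ₗ B.ε) (B.s f * h) = 0 :=
    fun f h hf => by
      simp [hs, B.ε_mul_s, hf]
  { f_surj := algHom_complex_surjective _
    φ_surj := hφ
    s := Algebra.ofId ℂ E
    t := opUnit E
    Δ := fiberLift hs hφ hker T hT
    ε := fiberLift hs hφ hker _ hε
    map_s := fun l => by rw [map_eq_algebraMap hker]; rfl
    map_t := fun l => by rw [hBt, map_eq_algebraMap hker]; rfl
    map_Δ := fun h u hu => by
      refine (fiberLift_apply hs hφ hker T hT h).trans ?_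
      simp only [T, LinearMap.comp_apply]
      rw [← hu, balancedMap_mk]
    map_ε := fun h => fiberLift_apply hs hφ hker _ hε h }

/-- A `C(X, ℂ)`-linear bijection descends to the fibres. -/
def fiberEquiv (hs : ∀ f h, s f * h = h * s f) (hφ : Function.Surjective φ)
    (hker : ∀ h, φ h = 0 ↔ h ∈ fiberIdeal s x) (S : H ≃ₗ[ℂ] H)
    (hS : ∀ f h, S (s f * h) = s f * S h) : E ≃ₗ[ℂ] E :=
  have h₁ : ∀ f h, f x = 0 → (φ.toLinearMap ∘ₗ S.toLinearMap) (s f * h) = 0 := fun f h hf => by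
    simp [hS, map_eq_algebraMap hker, hf]
  have h₂ : ∀ f h, f x = 0 → (φ.toLinearMap ∘ₗ S.symm.toLinearMap) (s f * h) = 0 :=
    fun f h hf => by
      have : S.symm (s f * h) = s f * S.symm h := by
        rw [LinearEquiv.symm_apply_eq, hS, LinearEquiv.apply_symm_apply]
      simp [this, map_eq_algebraMap hker, hf]
  LinearEquiv.ofLinearMap
    (fiberLift hs hφ hker _ h₁)
    (fiberLift hs hφ hker _ h₂)
    (LinearMap.ext fun v => by
      obtain ⟨h, rfl⟩ := hφ v
      rw [LinearMap.comp_apply, fiberLift_apply, LinearMap.comp_apply, AlgHom.toLinearMap_apply,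
        fiberLift_apply]
      simp)
    (LinearMap.ext fun v => by
      obtain ⟨h, rfl⟩ := hφ v
      rw [LinearMap.comp_apply, fiberLift_apply, LinearMap.comp_apply, AlgHom.toLinearMap_apply,
        fiberLift_apply]
      simp)

theorem fiberEquiv_apply (hs : ∀ f h, s f * h = h * s f) (hφ : Function.Surjective φ)
    (hker : ∀ h, φ h = 0 ↔ h ∈ fiberIdeal s x) (S : H ≃ₗ[ℂ] H)
    (hS : ∀ f h, S (s f * h) = s f * S h) (h : H) :
    fiberEquiv hs hφ hker S hS (φ h) = φ (S h) := by
  simp only [fiberEquiv, LinearEquiv.coe_ofLinearMap, fiberLift_apply]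
  rfl

theorem fiberEquiv_symm_apply (hs : ∀ f h, s f * h = h * s f) (hφ : Function.Surjective φ)
    (hker : ∀ h, φ h = 0 ↔ h ∈ fiberIdeal s x) (S : H ≃ₗ[ℂ] H)
    (hS : ∀ f h, S (s f * h) = s f * S h) (h : H) :
    (fiberEquiv hs hφ hker S hS).symm (φ h) = φ (S.symm h) := by
  rw [LinearEquiv.symm_apply_eq, fiberEquiv_apply, LinearEquiv.apply_symm_apply]

end Fiber

/-! ### Dual bases and the frames they induce on the fibres -/

section DualBasis

variable {X : Type*} [TopologicalSpace X] {H : Type*} [Ring H] [Algebra ℂ H]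

/-- A finite dual basis of `H` as a module over `C(X, ℂ)` through `s`. -/
structure SourceDualBasis (s : C(X, ℂ) →ₐ[ℂ] H) (n : ℕ) where
  b : Fin n → H
  c : H →ₗ[ℂ] (Fin n → C(X, ℂ))
  c_mul : ∀ f h, c (s f * h) = fun j => f * c h j
  sum_c_mul_b : ∀ h, ∑ j, s (c h j) * b j = h

/-- Projectivity splits a surjection `p` from a finite free module. The section `i` gives the
coefficients, the images under `p` of the standard basis give the `b j`, and `p ∘ i = id` is the
expansion formula. -/
theorem exists_sourceDualBasis (s : C(X, ℂ) →ₐ[ℂ] H)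
    (hfin : @Module.Finite C(X, ℂ) H _ _ (Module.compHom H (s : C(X, ℂ) →+* H)))
    (hproj : @Module.Projective C(X, ℂ) _ H _ (Module.compHom H (s : C(X, ℂ) →+* H))) :
    ∃ n, Nonempty (SourceDualBasis s n) := by
  let := Module.compHom H (s : C(X, ℂ) →+* H)
  have hsmul : ∀ (f : C(X, ℂ)) (h : H), f • h = s f * h := fun _ _ => rfl
  obtain ⟨n, p, hp⟩ := Module.Finite.exists_fin' C(X, ℂ) H
  obtain ⟨i, hi⟩ := Module.projective_lifting_property p LinearMap.id hp
  have hc : ∀ (z : ℂ) (h : H), i (z • h) = z • i h := fun z h => by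
    have : z • h = algebraMap ℂ C(X, ℂ) z • h := by
      rw [hsmul, AlgHom.commutes, Algebra.smul_def]
    rw [this, map_smul]
    ext j x
    simp
  refine ⟨n, ⟨⟨fun j => p (Pi.single j 1), ⟨⟨i, map_add i⟩, hc⟩, fun f h => ?_, fun h => ?_⟩⟩⟩
  · exact i.map_smul f h
  · conv_rhs => rw [← LinearMap.id_apply (R := C(X, ℂ)) h, ← hi, LinearMap.comp_apply,
      pi_eq_sum_univ' (i h), map_sum]
    refine Finset.sum_congr rfl fun j _ => ?_
    rw [map_smul, hsmul]
    rfl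

variable {s : C(X, ℂ) →ₐ[ℂ] H} {n : ℕ} (D : SourceDualBasis s n)
  {E : X → Type*} [∀ x, Ring (E x)] [∀ x, Algebra ℂ (E x)] {φ : ∀ x, H →ₐ[ℂ] E x}
  (hs : ∀ f h, s f * h = h * s f) (hφ : ∀ x, Function.Surjective (φ x))
  (hker : ∀ x h, φ x h = 0 ↔ h ∈ fiberIdeal s x)

namespace SourceDualBasis

/-- The coefficients at a point. -/
def coeff (x : X) : H →ₗ[ℂ] (Fin n → ℂ) :=
  (ContinuousMap.evalAlgHom ℂ ℂ x).toLinearMap.compLeft (Fin n) ∘ₗ D.c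

theorem coeff_apply (x : X) (h : H) (j : Fin n) : D.coeff x h j = D.c h j x := rfl

theorem coeff_mul (x : X) (f : C(X, ℂ)) (h : H) (hf : f x = 0) : D.coeff x (s f * h) = 0 := by
  ext j
  simp [coeff_apply, D.c_mul, hf]

/-- The frame of the family of fibres given by a dual basis. -/
def frame : GeneratingFrame E n where
  b j x := φ x (D.b j)
  c x := fiberLift hs (hφ x) (hker x) (D.coeff x) (D.coeff_mul x)
  sum_c_smul_b x v := by
    obtain ⟨h, rfl⟩ := hφ x v
    rw [fiberLift_apply]
    conv_rhs => rw [← D.sum_c_mul_b h]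
    simp [map_eq_algebraMap (hker x), coeff_apply, Algebra.smul_def]
  continuous_c_b j := by
    simp only [fiberLift_apply]
    exact continuous_pi fun i => (D.c (D.b j) i).continuous

theorem frame_c (x : X) (h : H) : (D.frame hs hφ hker).c x (φ x h) = D.coeff x h :=
  fiberLift_apply hs (hφ x) (hker x) _ (D.coeff_mul x) h

theorem continuous_frame_c (h : H) : Continuous fun x => (D.frame hs hφ hker).c x (φ x h) := by
  simp only [frame_c]
  exact continuous_pi fun i => (D.c h i).continuous

end SourceDualBasis

end DualBasis

theorem exists_fin_sum_tmul {M : Type*} [AddCommGroup M] [Module ℂ M] (u : M ⊗[ℂ] M) :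
    ∃ (m : ℕ) (a d : Fin m → M), u = ∑ i, a i ⊗ₜ[ℂ] d i := by
  obtain ⟨t, ht⟩ := TensorProduct.exists_finset u
  refine ⟨t.card, fun i => (t.equivFin.symm i).1.1, fun i => (t.equivFin.symm i).1.2, ?_⟩
  rw [t.equivFin.symm.sum_comp (fun i : t => i.1.1 ⊗ₜ[ℂ] i.1.2), ht]
  exact (Finset.sum_coe_sort t fun i => i.1 ⊗ₜ[ℂ] i.2).symm

/-- The value of `h` in the fibre at `x` determines its coefficients at `x`. If all values vanish,
the coefficient functions are zero, and so is `h`. -/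
theorem SourceDualBasis.fiberwise_injective {X : Type*} [TopologicalSpace X] {H : Type*} [Ring H]
    [Algebra ℂ H] {s : C(X, ℂ) →ₐ[ℂ] H} {n : ℕ} (D : SourceDualBasis s n)
    (hs : ∀ f h, s f * h = h * s f) {E : X → Type*} [∀ x, Ring (E x)] [∀ x, Algebra ℂ (E x)]
    {φ : ∀ x, H →ₐ[ℂ] E x} (hφ : ∀ x, Function.Surjective (φ x))
    (hker : ∀ x h, φ x h = 0 ↔ h ∈ fiberIdeal s x) : Function.Injective (AlgHom.pi φ) := by
  refine (injective_iff_map_eq_zero _).2 fun h hh => ?_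
  have hc : ∀ j, D.c h j = 0 := fun j => by
    ext x
    rw [← D.coeff_apply, ← D.frame_c hs hφ hker]
    have : φ x h = 0 := congrFun hh x
    simp [this]
  rw [← D.sum_c_mul_b h]
  simp [hc]

/-! ### Identification of the two base algebras; the fibre Hopf algebroids -/

namespace HopfAlgebroid

variable {X : Type*} [TopologicalSpace X] {L : Type*} [Ring L] [Algebra ℂ L]
  {H : Type*} [Ring H] [Algebra ℂ H] (𝓗 : HopfAlgebroid ℂ L C(X, ℂ) H)

theorem εR_sR (f : C(X, ℂ)) : 𝓗.right.ε (𝓗.right.s f) = f := by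
  rw [← one_mul (𝓗.right.s f), 𝓗.right.ε_mul_s, 𝓗.right.ε_one, one_mul]

theorem εL_sL (l : L) : 𝓗.left.ε (𝓗.left.s l) = l := by
  rw [← mul_one (𝓗.left.s l), 𝓗.left.ε_s_mul, 𝓗.left.ε_one, mul_one]

section

variable {𝓗} (hst : ∀ f : C(X, ℂ), 𝓗.right.t (op f) = 𝓗.right.s f)

theorem sR_εR_sL (hst : ∀ f : C(X, ℂ), 𝓗.right.t (op f) = 𝓗.right.s f) (l : L) :
    𝓗.right.s (𝓗.right.ε (𝓗.left.s l)) = 𝓗.left.s l := by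
  rw [← hst, 𝓗.tR_εR_sL]

/-- When source and target of the right bialgebroid agree, the left base algebra is identified
with the right one. -/
def baseEquiv : L ≃ₐ[ℂ] C(X, ℂ) :=
  -- Multiplicativity of `ε_R s_L` is tested after the injective map `s_R`, since `s_R ε_R s_L =
  -- s_L` is multiplicative.
  have hinj : Function.Injective 𝓗.right.s := Function.LeftInverse.injective 𝓗.εR_sR
  AlgEquiv.ofBijective
    (AlgHom.ofLinearMap (𝓗.right.ε ∘ₗ 𝓗.left.s.toLinearMap)
      (by simp [𝓗.right.ε_one])
      (fun l l' => hinj (by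
        simp only [LinearMap.comp_apply, AlgHom.toLinearMap_apply]
        rw [sR_εR_sL hst, map_mul, map_mul, sR_εR_sL hst, sR_εR_sL hst])))
    ⟨fun l l' h => by
      have h' : 𝓗.right.ε (𝓗.left.s l) = 𝓗.right.ε (𝓗.left.s l') := h
      rw [← 𝓗.εL_sL l, ← 𝓗.εL_sL l', ← sR_εR_sL hst l, h', sR_εR_sL hst],
    -- The preimage comes from `s_L ε_L t_R = t_R = s_R`, to which `ε_R` is applied.
    fun f => ⟨𝓗.left.ε (𝓗.right.t (op f)), by
      change 𝓗.right.ε (𝓗.left.s _) = f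
      rw [𝓗.sL_εL_tR, hst, 𝓗.εR_sR]⟩⟩

theorem sL_eq (l : L) : 𝓗.left.s l = 𝓗.right.s (baseEquiv hst l) := (sR_εR_sL hst l).symm

/-- Apply `t_L ε_L s_R = s_R` to `θ l`: there `s_R (θ l) = s_L l`, and `ε_L s_L = id`. -/
theorem tL_eq (l : L) : 𝓗.left.t (op l) = 𝓗.right.s (baseEquiv hst l) := by
  rw [← 𝓗.tL_εL_sR (baseEquiv hst l), ← sL_eq hst, 𝓗.εL_sL]

/-- This is the antipode's twisted linearity at `l = 1`; with `t_R = s_R` central, the twist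
disappears. -/
theorem S_sR_mul (hst : ∀ f : C(X, ℂ), 𝓗.right.t (op f) = 𝓗.right.s f)
    (hs : ∀ f h, 𝓗.right.s f * h = h * 𝓗.right.s f) (f : C(X, ℂ)) (h : H) :
    𝓗.S (𝓗.right.s f * h) = 𝓗.right.s f * 𝓗.S h := by
  have := 𝓗.S_mul 1 f h
  rwa [op_one, map_one, map_one, one_mul, mul_one, hst, ← hs] at this

variable (hs : ∀ f h, 𝓗.right.s f * h = h * 𝓗.right.s f)

section Point

variable {x : X} {E : Type*} [Ring E] [Algebra ℂ E] {φ : H →ₐ[ℂ] E}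
  (hφ : Function.Surjective φ) (hker : ∀ h, φ h = 0 ↔ h ∈ fiberIdeal 𝓗.right.s x)

/-- The Hopf algebroid structure on a fibre. -/
def fiber : HopfAlgebroid ℂ ℂ ℂ E :=
  𝓗.descend
    (𝓗.left.fiberDescent (baseEquiv hst : L →ₐ[ℂ] C(X, ℂ)) (baseEquiv hst).surjective
      (sL_eq hst) (tL_eq hst) hs hφ hker)
    (𝓗.right.fiberDescent hst hs hφ hker)
    (fiberEquiv hs hφ hker 𝓗.S (S_sR_mul hst hs))
    (fiberEquiv_apply hs hφ hker 𝓗.S (S_sR_mul hst hs))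

theorem fiber_isGeometricMorphism :
    𝓗.IsGeometricMorphism (fiber hst hs hφ hker)
      ((ContinuousMap.evalAlgHom ℂ ℂ x).comp (baseEquiv hst : L →ₐ[ℂ] C(X, ℂ)))
      (ContinuousMap.evalAlgHom ℂ ℂ x) φ :=
  𝓗.descend_isGeometricMorphism _ _ _ _

theorem fiber_S_symm (h : H) : (fiber hst hs hφ hker).S.symm (φ h) = φ (𝓗.S.symm h) :=
  fiberEquiv_symm_apply hs hφ hker 𝓗.S (S_sR_mul hst hs) h

end Point

end

end HopfAlgebroid

/-! ### Assembly of the bundle and its continuous sections -/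

section Bundle

variable {X : Type u} [TopologicalSpace X] {L : Type*} [Ring L] [Algebra ℂ L]
  {H : Type*} [Ring H] [Algebra ℂ H] {𝓗 : HopfAlgebroid ℂ L C(X, ℂ) H}
  (hst : ∀ f : C(X, ℂ), 𝓗.right.t (op f) = 𝓗.right.s f)
  (hs : ∀ f h, 𝓗.right.s f * h = h * 𝓗.right.s f)
  {n : ℕ} (D : SourceDualBasis 𝓗.right.s n)
  {E : X → Type v} [∀ x, Ring (E x)] [∀ x, Algebra ℂ (E x)] {φ : ∀ x, H →ₐ[ℂ] E x}
  (hφ : ∀ x, Function.Surjective (φ x))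
  (hker : ∀ x h, φ x h = 0 ↔ h ∈ fiberIdeal 𝓗.right.s x)

/-- The bundle of complex Hopf algebroids formed by the fibres of a Hopf algebroid over
`C(X, ℂ)`. -/
def HopfAlgebroid.bundle : HopfAlgebroidBundle.{u, v} X :=
  let F := D.frame hs hφ hker
  have geom := fun x => HopfAlgebroid.fiber_isGeometricMorphism hst hs (hφ x) (hker x)
  have hF : ∀ h, Continuous fun x => F.c x (φ x h) := D.continuous_frame_c hs hφ hker
  { fiber := E
    topology := F.topology
    isVectorBundle := F.isFiniteRankVectorBundle
    hopf := fun x => HopfAlgebroid.fiber hst hs (hφ x) (hker x)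
    continuous_one := by
      refine (F.continuous_section_iff fun x => (1 : E x)).2 ?_
      simpa only [map_one] using hF 1
    continuous_mul := by
      refine F.continuous_bilinear (fun x => LinearMap.mul ℂ (E x)) fun i j => ?_
      refine (hF (D.b i * D.b j)).congr fun x => ?_
      exact congrArg (F.c x) (map_mul (φ x) (D.b i) (D.b j))
    continuous_εL := by
      refine F.continuous_linear
        (fun x => (HopfAlgebroid.fiber hst hs (hφ x) (hker x)).left.ε) fun j => ?_
      refine (HopfAlgebroid.baseEquiv hst (𝓗.left.ε (D.b j))).continuous.congr fun x => ?_
      exact (geom x).εL (D.b j)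
    continuous_εR := by
      refine F.continuous_linear
        (fun x => (HopfAlgebroid.fiber hst hs (hφ x) (hker x)).right.ε) fun j => ?_
      refine (𝓗.right.ε (D.b j)).continuous.congr fun x => ?_
      exact (geom x).εR (D.b j)
    continuous_S := by
      refine F.continuous_endomorphism
        (fun x => (HopfAlgebroid.fiber hst hs (hφ x) (hker x)).S.toLinearMap) fun j => ?_
      refine (hF (𝓗.S (D.b j))).congr fun x => ?_
      exact congrArg (F.c x) ((geom x).S (D.b j))
    continuous_S_symm := by
      refine F.continuous_endomorphism
        (fun x => (HopfAlgebroid.fiber hst hs (hφ x) (hker x)).S.symm.toLinearMap) fun j => ?_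
      refine (hF (𝓗.S.symm (D.b j))).congr fun x => ?_
      exact congrArg (F.c x)
        (HopfAlgebroid.fiber_S_symm hst hs (hφ x) (hker x) (D.b j)).symm
    continuous_ΔL := fun U _ σ => by
      -- One representative of `Δ (b j)` in `H ⊗ H` serves all points at once: its tensor factors
      -- are elements of `H`, which define continuous sections.
      choose u hu using fun j => Submodule.Quotient.mk_surjective _ (𝓗.left.Δ (D.b j))
      choose m a d had using fun j => exists_fin_sum_tmul (u j)
      refine F.tensorSectionContinuousOn
        (fun x => (HopfAlgebroid.fiber hst hs (hφ x) (hker x)).left.Δ)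
        (a := fun j i x => φ x (a j i)) (d := fun j i x => φ x (d j i))
        (fun j i => hF _) (fun j i => hF _) (fun x j => ?_) U σ
      refine ((geom x).ΔL (D.b j) (u j) (hu j)).trans ?_
      simp only [had, map_sum, TensorProduct.map_tmul, AlgHom.toLinearMap_apply]
    continuous_ΔR := fun U _ σ => by
      choose u hu using fun j => Submodule.Quotient.mk_surjective _ (𝓗.right.Δ (D.b j))
      choose m a d had using fun j => exists_fin_sum_tmul (u j)
      refine F.tensorSectionContinuousOn
        (fun x => (HopfAlgebroid.fiber hst hs (hφ x) (hker x)).right.Δ)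
        (a := fun j i x => φ x (a j i)) (d := fun j i x => φ x (d j i))
        (fun j i => hF _) (fun j i => hF _) (fun x j => ?_) U σ
      refine ((geom x).ΔR (D.b j) (u j) (hu j)).trans ?_
      simp only [had, map_sum, TensorProduct.map_tmul, AlgHom.toLinearMap_apply] }

/-- Elements of `H` have continuous coefficients in the frame. Conversely the coefficients of a
continuous section are elements of `C(X, ℂ)`, and the corresponding combination of the `b j` in `H`
restricts to the section in each fibre. -/
theorem HopfAlgebroid.range_fiberwise :
    Set.range (AlgHom.pi φ) = (HopfAlgebroid.bundle hst hs D hφ hker).sections := by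
  let F := D.frame hs hφ hker
  ext σ
  constructor
  · rintro ⟨h, rfl⟩
    exact (F.continuous_section_iff fun x => φ x h).2 (D.continuous_frame_c hs hφ hker h)
  · intro hσ
    have hσ' : Continuous fun x => F.c x (σ x) := (F.continuous_section_iff σ).1 hσ
    refine ⟨∑ j, 𝓗.right.s ⟨fun x => F.c x (σ x) j, (continuous_apply j).comp hσ'⟩ * D.b j, ?_⟩
    funext x
    refine Eq.trans ?_ (F.sum_c_smul_b x (σ x))
    simp only [AlgHom.pi_apply, map_sum, map_mul, map_eq_algebraMap (hker x), ContinuousMap.coe_mk,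
      ← Algebra.smul_def]
    rfl

end Bundle

end

/-! ### The theorem, with the quotients of `H` as fibres -/

theorem theorem4 {X : Type u} [TopologicalSpace X] [CompactSpace X] [T2Space X]
    {L : Type w} [Ring L] [Algebra ℂ L] {H : Type v} [Ring H] [Algebra ℂ H]
    (𝓗 : HopfAlgebroid ℂ L C(X, ℂ) H)
    (hfin : @Module.Finite C(X, ℂ) H _ _ 𝓗.sourceModule)
    (hproj : @Module.Projective C(X, ℂ) _ H _ 𝓗.sourceModule)
    (hs : ∀ f : C(X, ℂ), 𝓗.right.s f ∈ Subalgebra.center ℂ H)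
    (ht : ∀ f : C(X, ℂ), 𝓗.right.t (MulOpposite.op f) ∈ Subalgebra.center ℂ H)
    (hst : ∀ f : C(X, ℂ), 𝓗.right.s f = 𝓗.right.t (MulOpposite.op f)) :
    ∃ (𝓔 : HopfAlgebroidBundle.{u, v} X) (Φ : H →ₐ[ℂ] ∀ x, 𝓔.fiber x) (θ : L ≃ₐ[ℂ] C(X, ℂ)),
      Function.Injective Φ ∧ Set.range Φ = 𝓔.sections ∧
      ∀ x : X, 𝓗.IsGeometricMorphism (𝓔.hopf x)
        ((ContinuousMap.evalAlgHom ℂ ℂ x).comp (θ : L →ₐ[ℂ] C(X, ℂ)))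
        (ContinuousMap.evalAlgHom ℂ ℂ x)
        ((Pi.evalAlgHom ℂ 𝓔.fiber x).comp Φ) := by
  have hs' : ∀ f h, 𝓗.right.s f * h = h * 𝓗.right.s f := fun f h =>
    (Subalgebra.mem_center_iff.1 (hs f) h).symm
  have hst' : ∀ f : C(X, ℂ), 𝓗.right.t (op f) = 𝓗.right.s f := fun f => (hst f).symm
  obtain ⟨n, ⟨D⟩⟩ := exists_sourceDualBasis 𝓗.right.s hfin hproj
  have := fiberIdeal_isTwoSided hs'
  let φ : ∀ x, H →ₐ[ℂ] H ⧸ fiberIdeal 𝓗.right.s x := fun x =>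
    Ideal.Quotient.mkₐ ℂ (fiberIdeal 𝓗.right.s x)
  have hφ : ∀ x, Function.Surjective (φ x) := fun x => Ideal.Quotient.mkₐ_surjective ℂ _
  have hker : ∀ x h, φ x h = 0 ↔ h ∈ fiberIdeal 𝓗.right.s x := fun x h =>
    Ideal.Quotient.eq_zero_iff_mem
  exact ⟨HopfAlgebroid.bundle hst' hs' D hφ hker, AlgHom.pi φ, HopfAlgebroid.baseEquiv hst',
    D.fiberwise_injective hs' hφ hker,
    HopfAlgebroid.range_fiberwise hst' hs' D hφ hker,
    fun x => HopfAlgebroid.fiber_isGeometricMorphism hst' hs' (hφ x) (hker x)⟩
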